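/- **Setting.** Let $\mathcal X\subset\mathbb R^{d_0}$ be compact, let $\phi_j:\mathcal X\to\mathbb R^{d_j}$ ($1\le j\le p$) be continuous, and put $k_j(x,x')=\phi_j(x)^T\phi_j(x')$, with $k_j\le 1$. The true kernel is $k^*=\sum_j\eta^*_jk_j$ with $\eta^*\ge 0$, $\|\eta^*\|_1\le 1$ and $J_{k^*}=\{j:\eta^*_j\neq0\}$; $\mathcal H_k$ and $\|\cdot\|_k$ denote the RKHS of a kernel $k$ and its norm. Let $\sigma>0$ and $m,n\ge1$. *Meta-data.* For each task $s\le m$ let $f_s\in\mathcal H_{k^*}$, $\|f_s\|_{k^*}\le B$, be written as $f_s(x)=\sum_{j\in J_{k^*}}\phi_j(x)^T\beta_s^{*(j)}$. For $i\le n$ one observes $y_{s,i}=f_s(x_{s,i})+\varepsilon_{s,i}$. The $mn$ points may be collected in any order and adaptively; each noise variable $\varepsilon_{s,i}$ is zero-mean sub-Gaussian with variance proxy $\sigma^2$ (i.e. $\mathbb E e^{u\varepsilon_{s,i}}\le e^{\sigma^2u^2/2}$ for all $u\in\mathbb R$) and independent of the past, including the current input $x_{s,i}$. For $b=(b_s^{(j)})_{s\le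 m,\,j\le p}$ with $b_s^{(j)}\in\mathbb R^{d_j}$ write $\|b^{(j)}\|^2=\sum_s\|b_s^{(j)}\|_2^2$, $\|b_J\|^2=\sum_{j\in J}\|b^{(j)}\|^2$ and $\|\Phi b\|^2=\sum_{s,i}\big(\sum_j\phi_j(x_{s,i})^Tb_s^{(j)}\big)^2$. Assume: 1. there is $c_1>0$ with $\|\beta^{*(j)}\|\ge c_1$ for all $j\in J_{k^*}$; 2. $|J_{k^*}|\le \bar s$, and for some $\kappa>0$, almost surely, $\|\Phi b\|\ge\kappa\sqrt{mn}\,\|b_J\|$ for all $J$ with $|J|\le \bar s$ and all $b\ne0$ with $\sum_{j\notin J}\|b^{(j)}\|\le3\sum_{j\in J}\|b^{(j)}\|$. Let $\delta\in(0,1)$, $d_{\max}=\max_jd_j$, and $$\rho=\sqrt{1+\tfrac2m\big(\log(2p/\delta)+\sqrt{m\,d_{\max}\log(2p/\delta)}\big)},\qquad \epsilon(n,m)=\frac{32\sigma \bar s}{\kappa^2\sqrt{mn}}\,\rho .$$ Let $\lambda\ge\frac{4\sigma}{\sqrt{mn}}\rho$ with $8\bar s\lambda/\kappa^2\le c_1$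 (for $\lambda=\frac{4\sigma}{\sqrt{mn}}\rho$ this reads $\epsilon(n,m)\le c_1$). Let $\hat\eta$ be the weight vector of a solution of $$\min_{\eta\ge0,\ f_1,\dots,f_m\in\mathcal H_k,\ k=\sum_j\eta_jk_j}\ \frac1m\sum_{s=1}^m\frac1n\sum_{i=1}^n(y_{s,i}-f_s(x_{s,i}))^2+\frac\lambda2\sum_{s=1}^m\|f_s\|_k^2+\frac\lambda2\|\eta\|_1 ,$$ chosen measurably from the meta-data, and put $\hat k=\sum_j\frac{\hat\eta_j}{c_1}k_j$ and $\hat d=\sum_{j:\hat\eta_j\ne0}d_j$. *GP-UCB.* Let $f\in\mathcal H_{k^*}$ with $\|f\|_{k^*}\le B$ and a global maximizer $x^*$. In round $t=1,2,\dots$ an input $x_t\in\mathcal X$, depending only on the past, is chosen and $f(x_t)+\varepsilon_t$ is observed, where $\varepsilon_t$ is zero-mean sub-Gaussian with variance proxy $\sigma^2$ and independent of the past, which includes the meta-data and $x_t$. Let $\hat\mu_{t-1}$ and $\hat\sigma_{t-1}$ be the posterior mean and standard deviation of $\mathrm{GP}(0,\hat k)$ given the first $t-1$ observations, with noise variance $\bar\sigma_t^2=1+2/t$,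 and let $$x_t\in\operatorname*{argmax}_{x\in\mathcal X}\ \hat\mu_{t-1}(x)+\nu_t\hat\sigma_{t-1}(x),\qquad \nu_t=B\Big(1+\frac{\epsilon(n,m)}{2c_1}\Big)+\sigma\sqrt{\hat d\log\Big(1+\frac{\bar\sigma_t^{-2}t}{c_1}\Big)+2+2\log(1/\delta)} .$$ **Claim.** There is a constant $C>0$ that depends only on $\sigma$ such that, in every setting as above, there is a (deterministic, setting-dependent) $T_0$ such that with probability greater than $1-\delta$ the cumulative regret $R_T=\sum_{t=1}^T[f(x^*)-f(x_t)]$ satisfies, for all $T\ge T_0$, $$R_T\le C\,\sqrt{\hat d\,T\log T}\,\Big(B\big(1+\epsilon(n,m)\big)+\sqrt{\hat d\log T+\log(1/\delta)}\Big),$$ and $R_T/T\to0$ as $T\to\infty$. -/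

import Mathlib

open MeasureTheory ProbabilityTheory Filter Topology
open scoped NNReal ENNReal

noncomputable section

namespace MetaKeL

/-! ### Kernels and reproducing kernel Hilbert spaces -/

/-- The mixture kernel `∑ j, η j * k_j`, where `k_j (x, x') = φ_j(x)ᵀ φ_j(x')`. -/
def mixKernel {X : Type*} {p : ℕ} {d : Fin p → ℕ}
    (φ : (j : Fin p) → X → EuclideanSpace ℝ (Fin (d j))) (η : Fin p → ℝ) (x x' : X) : ℝ :=
  ∑ j, η j * inner ℝ (φ j x) (φ j x')

/-- A real-valued kernel, written as a kernel of operators on the one-dimensional space `ℝ`. -/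
def opKernel {X : Type*} (k : X → X → ℝ) : Matrix X X (ℝ →L[ℝ] ℝ) :=
  Matrix.of fun x x' => k x x' • ContinuousLinearMap.id ℝ ℝ

/-- `f` belongs to the reproducing kernel Hilbert space of the positive semidefinite kernel `k`,
and its norm there is `r`. -/
def HasRKHSNorm {X : Type*} (k : X → X → ℝ) (f : X → ℝ) (r : ℝ) : Prop :=
  ∃ h : (opKernel k).PosSemidef,
    haveI : Fact (opKernel k).PosSemidef := ⟨h⟩
    ∃ g : RKHS.OfKernel (opKernel k), (∀ x, g x = f x) ∧ ‖g‖ = r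

/-- The index set of the base kernels that are active for the weights `η`. -/
def active {p : ℕ} (η : Fin p → ℝ) : Finset (Fin p) :=
  Finset.univ.filter fun j => η j ≠ 0

/-- The effective dimension `∑ d_j` over the active base kernels. -/
def effDim {p : ℕ} (d : Fin p → ℕ) (η : Fin p → ℝ) : ℕ := ∑ j ∈ active η, d j

/-! ### Multi-task coefficients and the restricted eigenvalue condition -/

/-- Multi-task coefficient vectors: one block of length `d j` per task and base kernel. -/
abbrev Coeff (m : ℕ) {p : ℕ} (d : Fin p → ℕ) : Type :=
  Fin m → (j : Fin p) → EuclideanSpace ℝ (Fin (d j))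

/-- Euclidean norm of the part of `b` that belongs to base kernel `j`, across all tasks. -/
def groupNorm {m p : ℕ} {d : Fin p → ℕ} (b : Coeff m d) (j : Fin p) : ℝ :=
  √(∑ s, ‖b s j‖ ^ 2)

/-- Euclidean norm of `Φ b`, where `Φ` is the block-diagonal multi-task feature matrix at the
inputs `x`. -/
def designNorm {X : Type*} {m n p : ℕ} {d : Fin p → ℕ}
    (φ : (j : Fin p) → X → EuclideanSpace ℝ (Fin (d j))) (x : Fin m → Fin n → X)
    (b : Coeff m d) : ℝ :=
  √(∑ s, ∑ i, (∑ j, inner ℝ (φ j (x s i)) (b s j)) ^ 2)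

/-- Relaxed sufficient exploration (restricted eigenvalue condition) with constant `κ` for at most
`S` groups. -/
def RelaxedExploration {X : Type*} {m n p : ℕ} {d : Fin p → ℕ}
    (φ : (j : Fin p) → X → EuclideanSpace ℝ (Fin (d j))) (x : Fin m → Fin n → X)
    (S : ℕ) (κ : ℝ) : Prop :=
  ∀ (J : Finset (Fin p)) (b : Coeff m d), J.card ≤ S → b ≠ 0 →
    ∑ j ∈ Jᶜ, groupNorm b j ≤ 3 * ∑ j ∈ J, groupNorm b j →
    κ * (√((m : ℝ) * n) * √(∑ j ∈ J, groupNorm b j ^ 2)) ≤ designNorm φ x b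

/-! ### The meta-learning problem -/

/-- The Meta-KeL objective for weights `η`, functions `g s` and RKHS norms `r s`. -/
def metaObjective {X : Type*} {m n p : ℕ} (lam : ℝ) (x : Fin m → Fin n → X)
    (y : Fin m → Fin n → ℝ) (η : Fin p → ℝ) (g : Fin m → X → ℝ) (r : Fin m → ℝ) : ℝ :=
  (1 / (m : ℝ)) * ∑ s, (1 / (n : ℝ)) * ∑ i, (y s i - g s (x s i)) ^ 2
    + lam / 2 * ∑ s, r s ^ 2 + lam / 2 * ∑ j, |η j|

/-- Feasibility for Meta-KeL: `η ≥ 0` and each `g s` lies in the RKHS of `∑ j, η j * k_j`, with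
norm `r s`. -/
def MetaFeasible {X : Type*} {m p : ℕ} {d : Fin p → ℕ}
    (φ : (j : Fin p) → X → EuclideanSpace ℝ (Fin (d j)))
    (η : Fin p → ℝ) (g : Fin m → X → ℝ) (r : Fin m → ℝ) : Prop :=
  (∀ j, 0 ≤ η j) ∧ ∀ s, HasRKHSNorm (mixKernel φ η) (g s) (r s)

/-- `η` is the weight vector of a minimizer of the Meta-KeL problem. -/
def IsMetaSolution {X : Type*} {m n p : ℕ} {d : Fin p → ℕ}
    (φ : (j : Fin p) → X → EuclideanSpace ℝ (Fin (d j))) (lam : ℝ) (x : Fin m → Fin n → X)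
    (y : Fin m → Fin n → ℝ) (η : Fin p → ℝ) : Prop :=
  ∃ (g : Fin m → X → ℝ) (r : Fin m → ℝ), MetaFeasible φ η g r ∧
    ∀ (η' : Fin p → ℝ) (g' : Fin m → X → ℝ) (r' : Fin m → ℝ), MetaFeasible φ η' g' r' →
      metaObjective lam x y η g r ≤ metaObjective lam x y η' g' r'

/-- The meta-learned kernel `∑ j, (η j / c₁) * k_j`. -/
def metaKernel {X : Type*} {p : ℕ} {d : Fin p → ℕ}
    (φ : (j : Fin p) → X → EuclideanSpace ℝ (Fin (d j))) (c₁ : ℝ) (η : Fin p → ℝ) :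
    X → X → ℝ :=
  mixKernel φ fun j => η j / c₁

/-- The factor `√(1 + (2/m) (log (2p/δ) + √(m d_max log (2p/δ))))`. -/
def rateFactor (m : ℕ) {p : ℕ} (d : Fin p → ℕ) (δ : ℝ) : ℝ :=
  √(1 + 2 / (m : ℝ) * (Real.log (2 * p / δ)
    + √((m : ℝ) * (Finset.univ.sup d : ℕ) * Real.log (2 * p / δ))))

/-- The smallest admissible regularization parameter. -/
def lamMin (σ : ℝ) (m n : ℕ) {p : ℕ} (d : Fin p → ℕ) (δ : ℝ) : ℝ :=
  4 * σ / √((m : ℝ) * n) * rateFactor m d δ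

/-- The recovery error `ε(n, m)`. -/
def recoveryErr (σ : ℝ) (m n : ℕ) {p : ℕ} (d : Fin p → ℕ) (δ κ : ℝ) (S : ℕ) : ℝ :=
  32 * σ * S / (κ ^ 2 * √((m : ℝ) * n)) * rateFactor m d δ

/-! ### Gaussian process posterior and GP-UCB

Rounds are numbered from `1`; the input and observation of round `t + 1` are `x t` and `y t`, so
that `x 0, …, x (t - 1)` is the history available at round `t + 1`. -/

/-- Regularized kernel matrix of the first `t` inputs. -/
def gram {X : Type*} (k : X → X → ℝ) (v : ℝ) (t : ℕ) (x : ℕ → X) : Matrix (Fin t) (Fin t) ℝ :=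
  Matrix.of (fun i j : Fin t => k (x i) (x j)) + v • (1 : Matrix (Fin t) (Fin t) ℝ)

/-- Posterior mean at `z` after `t` observations, with noise variance `v`. -/
def gpMean {X : Type*} (k : X → X → ℝ) (v : ℝ) (t : ℕ) (x : ℕ → X) (y : ℕ → ℝ) (z : X) : ℝ :=
  (fun i : Fin t => k z (x i)) ⬝ᵥ Matrix.mulVec (gram k v t x)⁻¹ (fun i : Fin t => y i)

/-- Posterior standard deviation at `z` after `t` observations, with noise variance `v`. -/
def gpStd {X : Type*} (k : X → X → ℝ) (v : ℝ) (t : ℕ) (x : ℕ → X) (z : X) : ℝ :=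
  √(k z z - (fun i : Fin t => k z (x i)) ⬝ᵥ
    Matrix.mulVec (gram k v t x)⁻¹ (fun i : Fin t => k z (x i)))

/-- The noise variance `1 + 2 / r` used at round `r`. -/
def noiseVar (r : ℕ) : ℝ := 1 + 2 / (r : ℝ)

/-- The exploration coefficient at round `r`, for recovery error `e` and effective dimension
`D`. -/
def explCoeff (σ B c₁ δ e : ℝ) (D r : ℕ) : ℝ :=
  B * (1 + e / (2 * c₁))
    + σ * √(D * Real.log (1 + (noiseVar r)⁻¹ * r / c₁) + 2 + 2 * Real.log (1 / δ))

/-- The inputs `x` follow GP-UCB with kernel `k` and exploration coefficients `ν`: in every round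
the input maximizes the upper confidence bound over the domain. -/
def IsGPUCB {X : Type*} (k : X → X → ℝ) (ν : ℕ → ℝ) (x : ℕ → X) (y : ℕ → ℝ) : Prop :=
  ∀ (t : ℕ) (z : X),
    gpMean k (noiseVar (t + 1)) t x y z + ν (t + 1) * gpStd k (noiseVar (t + 1)) t x z ≤
      gpMean k (noiseVar (t + 1)) t x y (x t)
        + ν (t + 1) * gpStd k (noiseVar (t + 1)) t x (x t)

/-- Cumulative regret after `T` rounds, with respect to the point `xstar`. -/
def regret {X : Type*} (f : X → ℝ) (xstar : X) (x : ℕ → X) (T : ℕ) : ℝ :=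
  ∑ t ∈ Finset.range T, (f xstar - f (x t))

/-- The rate `√(D T log T) (B (1 + e) + √(D log T + log (1/δ)))`. -/
def regretRate (B δ e : ℝ) (D T : ℕ) : ℝ :=
  √(D * T * Real.log T) * (B * (1 + e) + √(D * Real.log T + Real.log (1 / δ)))

end MetaKeL

end

/-!
The bound is asymptotic in `T`, and by continuity of measure along `T₀` it is enough that, with
probability larger than `1 - δ`, it holds from some path-dependent round on.

*Recovery of the support.* A feasible point of Meta-KeL costs at least as much as its coefficient
vector does in the group lasso, and the weights `η_j = ‖β^(j)‖` attain the group lasso cost of any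
coefficients `β` (`exists_groupLasso_le_metaObjective`, `exists_metaObjective_le_groupLasso`); this
only needs that the space of a mixture kernel consists of the functions that are linear in the joint
feature map, with the quotient norm. If the noise of each block is at most `m n λ / 4`, the usual
cone argument bounds the error of every active block by less than `c₁`, so no active kernel is
discarded (`subset_active_of_isMetaSolution`). The noise condition has probability at least
`1 - δ / 2` (`measure_metaNoise_le`).

*Self-normalized noise.* For predictable features `ψ` and independent sub-Gaussian noise `ε`, put
`G_t = ρ I + ∑ ψ ψᵀ`, `M_t = ∑ ε ψ` and `Q_t = M_tᵀ G_t⁻¹ M_t`. The process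
`exp (Q_t / 2σ²) √(ρ ^ D / det G_t)` is a supermartingale: its one-step increments are controlled by
the Sherman–Morrison formula and a one-dimensional Gaussian average. Ville's inequality turns this
into `measure_selfNorm_ge_le`, which serves both phases. For the online phase it gives more than the
classical `Q_t ≤ σ² (D log t + O(1))`: almost surely, eventually `Q_t ≤ σ² (D - 1/8) log t`
(`ae_eventually_selfNorm_le`). Either `log det G_t ≤ (D - 1/4) log t`, or all eigenvalues of `G_t`
are at least of order `t ^ (3/4)`, and then the regularization can be raised to order `√t`.

*Regret.* The gain in `Q_t` absorbs every constant: whatever the norm of the reward function in the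
meta-learned space is, the exploration coefficient eventually exceeds the width of the confidence
interval (`eventually_le_explCoeff`). This step needs only that the reward function is linear in the
recovered features, and it works with the unweighted features of a fixed set of kernels, so the
randomness of the learned weights does no harm. From there on the regret of a round is at most twice
the exploration bonus, and the squared bonuses sum to `log det G_T` (`eventually_sum_le`). All
lower-order terms, including those that depend on the norm bound and on `c₁`, are dominated
eventually, which leaves a constant that depends on `σ` only.
-/

open MeasureTheory ProbabilityTheory Filter Topology
open scoped NNReal ENNReal

namespace MetaKeL

/-! ### Quadratic forms of positive definite matrices -/

section LinearAlgebra

open Matrix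

variable {ι : Type*} [Fintype ι] {G G' : Matrix ι ι ℝ}

lemma dotProduct_mulVec_comm (hG : G.PosDef) (a b : ι → ℝ) :
    a ⬝ᵥ G *ᵥ b = b ⬝ᵥ G *ᵥ a := by
  have hT : G.IsSymm := by simpa using hG.isHermitian
  rw [dotProduct_comm b, dotProduct_mulVec, ← mulVec_transpose, hT.eq]

lemma quadForm_nonneg (hG : G.PosDef) (a : ι → ℝ) : 0 ≤ a ⬝ᵥ G *ᵥ a := by
  simpa using hG.posSemidef.dotProduct_mulVec_nonneg a

lemma vecMulVec_mulVec_self (a x : ι → ℝ) : vecMulVec a a *ᵥ x = (a ⬝ᵥ x) • a := by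
  ext i
  simp [mulVec, vecMulVec_apply, dotProduct, Finset.mul_sum, mul_comm, mul_left_comm]

lemma posDef_add_vecMulVec (hG : G.PosDef) (a : ι → ℝ) : (G + vecMulVec a a).PosDef := by
  refine hG.add_posSemidef ?_
  simpa using posSemidef_vecMulVec_self_star a

variable [DecidableEq ι]

lemma mulVec_inv_mulVec (hG : G.PosDef) (a : ι → ℝ) : G *ᵥ (G⁻¹ *ᵥ a) = a := by
  rw [mulVec_mulVec, mul_nonsing_inv _ ((isUnit_iff_isUnit_det _).1 hG.isUnit), one_mulVec]

lemma inv_mulVec_mulVec (hG : G.PosDef) (a : ι → ℝ) : G⁻¹ *ᵥ (G *ᵥ a) = a := by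
  rw [mulVec_mulVec, nonsing_inv_mul _ ((isUnit_iff_isUnit_det _).1 hG.isUnit), one_mulVec]

/-- Cauchy–Schwarz for the dual pair of norms given by `G` and `G⁻¹`. -/
lemma sq_dotProduct_le (hG : G.PosDef) (a b : ι → ℝ) :
    (a ⬝ᵥ b) ^ 2 ≤ (a ⬝ᵥ G *ᵥ a) * (b ⬝ᵥ G⁻¹ *ᵥ b) := by
  set w := G⁻¹ *ᵥ b with hw
  have hGw : G *ᵥ w = b := mulVec_inv_mulVec hG b
  have key : ∀ c : ℝ, 0 ≤ (b ⬝ᵥ w) * (c * c) + (-(2 * (a ⬝ᵥ b))) * c + a ⬝ᵥ G *ᵥ a := by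
    intro c
    have h := quadForm_nonneg hG (a - c • w)
    have h2 : w ⬝ᵥ G *ᵥ a = a ⬝ᵥ b := by rw [dotProduct_mulVec_comm hG, hGw]
    rw [mulVec_sub, mulVec_smul, hGw] at h
    simp only [dotProduct_sub, sub_dotProduct, smul_dotProduct, dotProduct_smul, smul_eq_mul,
      h2] at h
    rw [dotProduct_comm w b] at h
    linarith
  have := discrim_le_zero key
  rw [discrim] at this
  nlinarith

/-- Inversion reverses the Loewner order, with a multiplicative constant. -/
lemma inv_quadForm_le (hG : G.PosDef) (hG' : G'.PosDef) {c : ℝ}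
    (h : ∀ w, w ⬝ᵥ G *ᵥ w ≤ c * (w ⬝ᵥ G' *ᵥ w)) (x : ι → ℝ) :
    x ⬝ᵥ G'⁻¹ *ᵥ x ≤ c * (x ⬝ᵥ G⁻¹ *ᵥ x) := by
  set w := G'⁻¹ *ᵥ x with hw
  have hGw : G' *ᵥ w = x := mulVec_inv_mulVec hG' x
  have h1 := sq_dotProduct_le hG w x
  have h2 := h w
  rw [hGw, dotProduct_comm w x] at h2
  rw [dotProduct_comm w x] at h1
  have h3 : 0 ≤ x ⬝ᵥ G⁻¹ *ᵥ x := quadForm_nonneg hG.inv x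
  have h4 : 0 ≤ x ⬝ᵥ w := by rw [hw]; exact quadForm_nonneg hG'.inv x
  rcases h4.eq_or_lt with h0 | h0
  · rw [← h0] at h2
    rw [← h0]
    by_cases hx : x = 0
    · simp [hx]
    · have : 0 < x ⬝ᵥ w := by simpa using hG'.inv.dotProduct_mulVec_pos hx
      linarith
  · have h5 : (x ⬝ᵥ w) * (x ⬝ᵥ w) ≤ (c * (x ⬝ᵥ G⁻¹ *ᵥ x)) * (x ⬝ᵥ w) := by
      calc (x ⬝ᵥ w) * (x ⬝ᵥ w) = (x ⬝ᵥ w) ^ 2 := by ring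
        _ ≤ (w ⬝ᵥ G *ᵥ w) * (x ⬝ᵥ G⁻¹ *ᵥ x) := h1
        _ ≤ (c * (x ⬝ᵥ w)) * (x ⬝ᵥ G⁻¹ *ᵥ x) := by gcongr
        _ = _ := by ring
    exact le_of_mul_le_mul_right h5 h0

lemma log_det_le_of_trace_le (hG : G.PosDef) {c : ℝ} (hc : 0 < c)
    (h : G.trace ≤ Fintype.card ι * c) : Real.log G.det ≤ Fintype.card ι * Real.log c := by
  have hdet := hG.isHermitian.det_eq_prod_eigenvalues
  have htr := hG.isHermitian.trace_eq_sum_eigenvalues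
  simp only [RCLike.ofReal_real_eq_id, id_eq] at hdet htr
  rw [hdet, Real.log_prod fun i _ => (hG.eigenvalues_pos i).ne']
  have h1 : ∀ i, Real.log (hG.isHermitian.eigenvalues i) ≤
      hG.isHermitian.eigenvalues i / c - 1 + Real.log c := by
    intro i
    have h2 := Real.log_le_sub_one_of_pos (div_pos (hG.eigenvalues_pos i) hc)
    rw [Real.log_div (hG.eigenvalues_pos i).ne' hc.ne'] at h2
    linarith
  refine (Finset.sum_le_sum fun i _ => h1 i).trans ?_
  rw [Finset.sum_add_distrib, Finset.sum_sub_distrib, ← Finset.sum_div, ← htr]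
  simp only [Finset.sum_const, Finset.card_univ, nsmul_eq_mul, mul_one]
  have : G.trace / c ≤ Fintype.card ι := by rw [div_le_iff₀ hc]; exact h
  linarith

/-- If all eigenvalues are at most `Λ`, then the least one is at least `det G / Λ ^ (d - 1)`. -/
lemma det_mul_dotProduct_le (hG : G.PosDef) {Λ : ℝ}
    (h : ∀ w : ι → ℝ, w ⬝ᵥ G *ᵥ w ≤ Λ * (w ⬝ᵥ w)) (w : ι → ℝ) :
    G.det * (w ⬝ᵥ w) ≤ Λ ^ (Fintype.card ι - 1) * (w ⬝ᵥ G *ᵥ w) := by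
  have hdet := hG.isHermitian.det_eq_prod_eigenvalues
  simp only [RCLike.ofReal_real_eq_id, id_eq] at hdet
  set ev := hG.isHermitian.eigenvalues
  set v := hG.isHermitian.eigenvectorBasis
  have hpos : ∀ i, 0 < ev i := hG.eigenvalues_pos
  have hGv : ∀ i, G *ᵥ (v i).ofLp = ev i • (v i).ofLp := fun i => by
    simpa using hG.isHermitian.mulVec_eigenvectorBasis i
  have hvv : ∀ i, (v i).ofLp ⬝ᵥ (v i).ofLp = 1 := by
    intro i
    have := v.orthonormal.1 i
    have h2 : inner ℝ (v i) (v i) = (1 : ℝ) := by rw [real_inner_self_eq_norm_sq, this]; norm_num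
    rw [EuclideanSpace.inner_eq_star_dotProduct] at h2
    simpa using h2
  have hle : ∀ i, ev i ≤ Λ := by
    intro i
    have := h (v i).ofLp
    rw [hGv, dotProduct_smul, hvv] at this
    simpa using this
  have hexp : ∀ a : ι → ℝ, w ⬝ᵥ a = ∑ i, ((v i).ofLp ⬝ᵥ w) * ((v i).ofLp ⬝ᵥ a) := by
    intro a
    have := v.sum_inner_mul_inner (WithLp.toLp 2 w) (WithLp.toLp 2 a)
    simp only [EuclideanSpace.inner_eq_star_dotProduct, star_trivial] at this
    rw [dotProduct_comm w a, ← this]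
    refine Finset.sum_congr rfl fun i _ => ?_
    rw [dotProduct_comm a]
  have hGa : ∀ i, (v i).ofLp ⬝ᵥ G *ᵥ w = ev i * ((v i).ofLp ⬝ᵥ w) := by
    intro i
    rw [dotProduct_mulVec_comm hG, hGv, dotProduct_smul, dotProduct_comm, smul_eq_mul]
  rw [hexp w, hexp (G *ᵥ w), Finset.mul_sum, Finset.mul_sum]
  refine Finset.sum_le_sum fun i _ => ?_
  rw [hGa]
  have hprod : G.det ≤ Λ ^ (Fintype.card ι - 1) * ev i := by
    rw [hdet, ← Finset.prod_erase_mul _ _ (Finset.mem_univ i)]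
    have : ∏ j ∈ Finset.univ.erase i, ev j ≤ Λ ^ (Fintype.card ι - 1) := by
      calc _ ≤ ∏ j ∈ Finset.univ.erase i, Λ :=
            Finset.prod_le_prod (fun j _ => (hpos j).le) fun j _ => hle j
        _ = _ := by simp [Finset.card_erase_of_mem]
    exact mul_le_mul_of_nonneg_right this (hpos i).le
  calc _ = G.det * ((v i).ofLp ⬝ᵥ w) ^ 2 := by ring
    _ ≤ (Λ ^ (Fintype.card ι - 1) * ev i) * ((v i).ofLp ⬝ᵥ w) ^ 2 := by gcongr
    _ = _ := by ring

/-- The matrix determinant lemma for a symmetric rank-one update. -/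
lemma det_add_vecMulVec (hG : G.PosDef) (a : ι → ℝ) :
    (G + vecMulVec a a).det = G.det * (1 + a ⬝ᵥ G⁻¹ *ᵥ a) := by
  rw [vecMulVec_eq Unit, det_add_replicateCol_mul_replicateRow
    ((isUnit_iff_isUnit_det _).1 hG.isUnit)]
  congr 1
  rw [det_unique]
  simp [replicateRow, replicateCol, Matrix.mul_apply, dotProduct, mulVec, Finset.mul_sum,
    Finset.sum_mul]
  rw [Finset.sum_comm]
  simp [mul_assoc]

/-- The Sherman–Morrison formula, as an identity between quadratic forms. -/
lemma quadForm_inv_add_vecMulVec (hG : G.PosDef) (a x : ι → ℝ) :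
    x ⬝ᵥ (G + vecMulVec a a)⁻¹ *ᵥ x =
      x ⬝ᵥ G⁻¹ *ᵥ x - (a ⬝ᵥ G⁻¹ *ᵥ x) ^ 2 / (1 + a ⬝ᵥ G⁻¹ *ᵥ a) := by
  have hG' := posDef_add_vecMulVec hG a
  have hu : 0 ≤ a ⬝ᵥ G⁻¹ *ᵥ a := quadForm_nonneg hG.inv a
  set u := a ⬝ᵥ G⁻¹ *ᵥ a with hu'
  set b := a ⬝ᵥ G⁻¹ *ᵥ x with hb
  have h1 : (G + vecMulVec a a) *ᵥ (G⁻¹ *ᵥ x - (b / (1 + u)) • G⁻¹ *ᵥ a) = x := by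
    rw [add_mulVec, mulVec_sub, mulVec_inv_mulVec hG, mulVec_smul, mulVec_inv_mulVec hG,
      vecMulVec_mulVec_self, dotProduct_sub, dotProduct_smul, ← hu', ← hb]
    have : b - (b / (1 + u)) • u = b / (1 + u) := by
      rw [smul_eq_mul]; field_simp; ring
    rw [this]; simp
  have h2 : (G + vecMulVec a a)⁻¹ *ᵥ x = G⁻¹ *ᵥ x - (b / (1 + u)) • G⁻¹ *ᵥ a := by
    conv_lhs => rw [← h1]
    rw [inv_mulVec_mulVec hG']
  rw [h2, dotProduct_sub, dotProduct_smul, dotProduct_mulVec_comm hG.inv x a, ← hb, smul_eq_mul]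
  ring

end LinearAlgebra

/-! ### Regularized Gram matrices and self-normalized sums -/

section SelfNormalized

open Matrix

variable {ι : Type*} [Fintype ι] [DecidableEq ι]

/-- The regularized Gram matrix `ρ I + ∑ s < t, ψ s (ψ s)ᵀ` of the first `t` feature vectors. -/
noncomputable def regGram (ρ : ℝ) (ψ : ℕ → ι → ℝ) (t : ℕ) : Matrix ι ι ℝ :=
  ρ • (1 : Matrix ι ι ℝ) + ∑ s ∈ Finset.range t, vecMulVec (ψ s) (ψ s)

/-- The noise-weighted sum `∑ s < t, ε s ψ s` of the first `t` feature vectors. -/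
def noiseSum (ψ : ℕ → ι → ℝ) (ε : ℕ → ℝ) (t : ℕ) : ι → ℝ :=
  ∑ s ∈ Finset.range t, ε s • ψ s

/-- The squared norm of the noise-weighted sum, normalized by the regularized Gram matrix. -/
noncomputable def selfNorm (ρ : ℝ) (ψ : ℕ → ι → ℝ) (ε : ℕ → ℝ) (t : ℕ) : ℝ :=
  noiseSum ψ ε t ⬝ᵥ (regGram ρ ψ t)⁻¹ *ᵥ noiseSum ψ ε t

lemma regGram_posDef {ρ : ℝ} (hρ : 0 < ρ) (ψ : ℕ → ι → ℝ) (t : ℕ) : (regGram ρ ψ t).PosDef := by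
  refine (PosDef.one.smul hρ).add_posSemidef (posSemidef_sum _ fun s _ => ?_)
  simpa using posSemidef_vecMulVec_self_star (ψ s)

omit [Fintype ι] in
lemma regGram_succ (ρ : ℝ) (ψ : ℕ → ι → ℝ) (t : ℕ) :
    regGram ρ ψ (t + 1) = regGram ρ ψ t + vecMulVec (ψ t) (ψ t) := by
  rw [regGram, regGram, Finset.sum_range_succ, add_assoc]

omit [DecidableEq ι] in
lemma sum_vecMulVec_mulVec (ψ : ℕ → ι → ℝ) (t : ℕ) (w : ι → ℝ) :
    (∑ s ∈ Finset.range t, vecMulVec (ψ s) (ψ s)) *ᵥ w =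
      ∑ s ∈ Finset.range t, (ψ s ⬝ᵥ w) • ψ s := by
  simp only [sum_mulVec, vecMulVec_mulVec_self]

lemma regGram_quadForm (ρ : ℝ) (ψ : ℕ → ι → ℝ) (t : ℕ) (w : ι → ℝ) :
    w ⬝ᵥ regGram ρ ψ t *ᵥ w = ρ * (w ⬝ᵥ w) + ∑ s ∈ Finset.range t, (ψ s ⬝ᵥ w) ^ 2 := by
  rw [regGram, add_mulVec, sum_vecMulVec_mulVec, smul_mulVec, one_mulVec, dotProduct_add,
    dotProduct_smul, dotProduct_sum, smul_eq_mul]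
  congr 1
  refine Finset.sum_congr rfl fun s _ => ?_
  rw [dotProduct_smul, smul_eq_mul, dotProduct_comm w, sq]

lemma regGram_trace (ρ : ℝ) (ψ : ℕ → ι → ℝ) (t : ℕ) :
    (regGram ρ ψ t).trace = ρ * Fintype.card ι + ∑ s ∈ Finset.range t, ψ s ⬝ᵥ ψ s := by
  simp [regGram, trace_add, trace_smul, trace_sum, trace_vecMulVec]

lemma log_det_regGram_succ {ρ : ℝ} (hρ : 0 < ρ) (ψ : ℕ → ι → ℝ) (t : ℕ) :
    Real.log (regGram ρ ψ (t + 1)).det = Real.log (regGram ρ ψ t).det +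
      Real.log (1 + ψ t ⬝ᵥ (regGram ρ ψ t)⁻¹ *ᵥ ψ t) := by
  have hG := regGram_posDef hρ ψ t
  have := quadForm_nonneg hG.inv (ψ t)
  rw [regGram_succ, det_add_vecMulVec hG, Real.log_mul hG.det_pos.ne' (by positivity)]

lemma log_det_regGram_zero (ρ : ℝ) (ψ : ℕ → ι → ℝ) :
    Real.log (regGram ρ ψ 0).det = Fintype.card ι * Real.log ρ := by
  simp [regGram, Real.log_pow]

lemma selfNorm_zero (ρ : ℝ) (ψ : ℕ → ι → ℝ) (ε : ℕ → ℝ) : selfNorm ρ ψ ε 0 = 0 := by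
  simp [selfNorm, noiseSum]

lemma selfNorm_nonneg {ρ : ℝ} (hρ : 0 < ρ) (ψ : ℕ → ι → ℝ) (ε : ℕ → ℝ) (t : ℕ) :
    0 ≤ selfNorm ρ ψ ε t := quadForm_nonneg (regGram_posDef hρ ψ t).inv _

lemma selfNorm_succ {ρ : ℝ} (hρ : 0 < ρ) (ψ : ℕ → ι → ℝ) (ε : ℕ → ℝ) (t : ℕ) :
    selfNorm ρ ψ ε (t + 1) = selfNorm ρ ψ ε t +
      (2 * (ψ t ⬝ᵥ (regGram ρ ψ t)⁻¹ *ᵥ noiseSum ψ ε t) * ε t +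
        (ψ t ⬝ᵥ (regGram ρ ψ t)⁻¹ *ᵥ ψ t) * ε t ^ 2 -
        (ψ t ⬝ᵥ (regGram ρ ψ t)⁻¹ *ᵥ noiseSum ψ ε t) ^ 2) /
        (1 + ψ t ⬝ᵥ (regGram ρ ψ t)⁻¹ *ᵥ ψ t) := by
  have hG := regGram_posDef hρ ψ t
  have hM : noiseSum ψ ε (t + 1) = noiseSum ψ ε t + ε t • ψ t := by
    rw [noiseSum, noiseSum, Finset.sum_range_succ]
  have hu := quadForm_nonneg hG.inv (ψ t)
  rw [selfNorm, regGram_succ, quadForm_inv_add_vecMulVec hG, hM, selfNorm]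
  simp only [mulVec_add, mulVec_smul, dotProduct_add, add_dotProduct, dotProduct_smul,
    smul_dotProduct, smul_eq_mul, dotProduct_mulVec_comm hG.inv (noiseSum ψ ε t) (ψ t)]
  field_simp
  ring

end SelfNormalized

/-! ### Measurability of matrix expressions -/

section Measurability

open Matrix

variable {Ω ι : Type*} {m : MeasurableSpace Ω} [Fintype ι]

lemma measurable_dotProduct {a b : Ω → ι → ℝ} (ha : Measurable a) (hb : Measurable b) :
    Measurable fun ω => a ω ⬝ᵥ b ω :=
  Finset.measurable_sum _ fun i _ => (measurable_pi_iff.1 ha i).mul (measurable_pi_iff.1 hb i)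

lemma measurable_mulVec {A : Ω → Matrix ι ι ℝ} {b : Ω → ι → ℝ}
    (hA : ∀ i j, Measurable fun ω => A ω i j) (hb : Measurable b) :
    Measurable fun ω => A ω *ᵥ b ω :=
  measurable_pi_iff.2 fun i => Finset.measurable_sum _ fun j _ =>
    (hA i j).mul (measurable_pi_iff.1 hb j)

variable [DecidableEq ι]

lemma measurable_det {A : Ω → Matrix ι ι ℝ} (hA : ∀ i j, Measurable fun ω => A ω i j) :
    Measurable fun ω => (A ω).det := by
  simp only [det_apply]
  exact Finset.measurable_sum _ fun σ _ =>
    (Finset.measurable_prod _ fun i _ => hA (σ i) i).const_smul _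

lemma measurable_inv_apply {A : Ω → Matrix ι ι ℝ} (hA : ∀ i j, Measurable fun ω => A ω i j)
    (i j : ι) : Measurable fun ω => (A ω)⁻¹ i j := by
  have h : ∀ ω, (A ω)⁻¹ i j = (A ω).det⁻¹ * ((A ω).updateRow j (Pi.single i 1)).det := fun ω => by
    rw [inv_def, Matrix.smul_apply, Ring.inverse_eq_inv', smul_eq_mul, adjugate_apply]
  simp_rw [h]
  refine (measurable_det hA).inv.mul (measurable_det fun k l => ?_)
  by_cases hk : k = j
  · subst hk
    simp only [updateRow_self]
    exact measurable_const
  · simp only [updateRow_ne hk]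
    exact hA k l

variable {ψ : ℕ → Ω → ι → ℝ} {ε : ℕ → Ω → ℝ} {t : ℕ}

omit [Fintype ι] in
lemma measurable_regGram (ρ : ℝ) (hψ : ∀ s < t, Measurable (ψ s)) (i j : ι) :
    Measurable fun ω => regGram ρ (fun s => ψ s ω) t i j := by
  simp only [regGram, Matrix.add_apply, Matrix.sum_apply, vecMulVec_apply]
  refine measurable_const.add (Finset.measurable_sum _ fun s hs => ?_)
  have := hψ s (Finset.mem_range.1 hs)
  exact (measurable_pi_iff.1 this i).mul (measurable_pi_iff.1 this j)

omit [Fintype ι] [DecidableEq ι] in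
lemma measurable_noiseSum (hψ : ∀ s < t, Measurable (ψ s)) (hε : ∀ s < t, Measurable (ε s)) :
    Measurable fun ω => noiseSum (fun s => ψ s ω) (fun s => ε s ω) t := by
  refine measurable_pi_iff.2 fun i => ?_
  simp only [noiseSum, Finset.sum_apply, Pi.smul_apply, smul_eq_mul]
  exact Finset.measurable_sum _ fun s hs => (hε s (Finset.mem_range.1 hs)).mul
    (measurable_pi_iff.1 (hψ s (Finset.mem_range.1 hs)) i)

lemma measurable_selfNorm (ρ : ℝ) (hψ : ∀ s < t, Measurable (ψ s))
    (hε : ∀ s < t, Measurable (ε s)) :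
    Measurable fun ω => selfNorm ρ (fun s => ψ s ω) (fun s => ε s ω) t :=
  measurable_dotProduct (measurable_noiseSum hψ hε)
    (measurable_mulVec (measurable_inv_apply (measurable_regGram ρ hψ))
      (measurable_noiseSum hψ hε))

end Measurability

/-! ### A maximal inequality for self-normalized sums of sub-Gaussian noise -/

section Maximal

variable {Ω : Type*} {mΩ : MeasurableSpace Ω} {P : Measure Ω}

/-- The exponential moment of a quadratic polynomial in a sub-Gaussian variable. The square in the
exponent is linearized by averaging over an auxiliary standard Gaussian. -/
lemma lintegral_exp_quadratic_le [IsProbabilityMeasure P] {X : Ω → ℝ} (hX : Measurable X)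
    {c : ℝ≥0} (hc : 0 < c) (hs : HasSubgaussianMGF X c P) (b : ℝ) {u : ℝ} (hu : 0 ≤ u) :
    ∫⁻ ω, ENNReal.ofReal (Real.exp (((2 * b * X ω + u * X ω ^ 2 - b ^ 2) / (1 + u) / c
      - Real.log (1 + u)) / 2)) ∂P ≤ 1 := by
  have hc' : (0 : ℝ) < c := hc
  set v : ℝ≥0 := ⟨1 + u, by positivity⟩ with hv
  have hvr : (v : ℝ) = 1 + u := rfl
  have hv0 : v ≠ 0 := by
    intro h
    have : (v : ℝ) = 0 := by rw [h]; rfl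
    rw [hvr] at this; linarith
  set s : ℝ := √(u / (c * (1 + u))) with hsdef
  have hs2 : s ^ 2 = u / (c * (1 + u)) := Real.sq_sqrt (by positivity)
  set α : ℝ := b / (c * (1 + u)) with hα
  set K : ℝ := Real.exp ((- b ^ 2 / (1 + u) / c - Real.log (1 + u)) / 2) with hK
  have hmgf : ∀ x : ℝ, ENNReal.ofReal (Real.exp (s ^ 2 * x ^ 2 / 2)) =
      ∫⁻ g, ENNReal.ofReal (Real.exp (s * x * g)) ∂(gaussianReal 0 1) := by
    intro x
    have h1 := mgf_gaussianReal (p := gaussianReal 0 1) (X := id) (by simp : _ = gaussianReal 0 1)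
      (s * x)
    rw [mgf] at h1
    rw [← ofReal_integral_eq_lintegral_ofReal]
    · congr 1
      simp only [id] at h1
      rw [h1]; congr 1; push_cast; ring
    · exact integrable_exp_mul_gaussianReal (s * x)
    · exact ae_of_all _ fun g => (Real.exp_pos _).le
  have hsub : ∀ r : ℝ, ∫⁻ ω, ENNReal.ofReal (Real.exp (r * X ω)) ∂P ≤
      ENNReal.ofReal (Real.exp (c * r ^ 2 / 2)) := by
    intro r
    rw [← ofReal_integral_eq_lintegral_ofReal (hs.integrable_exp_mul r)
      (ae_of_all _ fun g => (Real.exp_pos _).le)]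
    exact ENNReal.ofReal_le_ofReal (hs.mgf_le r)
  have hsplit : ∀ ω, ENNReal.ofReal (Real.exp (((2 * b * X ω + u * X ω ^ 2 - b ^ 2) / (1 + u) / c
      - Real.log (1 + u)) / 2)) = ENNReal.ofReal K *
      ∫⁻ g, ENNReal.ofReal (Real.exp ((α + s * g) * X ω)) ∂(gaussianReal 0 1) := by
    intro ω
    have h1 : ∀ g : ℝ, ENNReal.ofReal (Real.exp ((α + s * g) * X ω)) =
        ENNReal.ofReal (Real.exp (α * X ω)) * ENNReal.ofReal (Real.exp (s * X ω * g)) := by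
      intro g
      rw [← ENNReal.ofReal_mul (Real.exp_pos _).le, ← Real.exp_add]
      congr 2; ring
    simp_rw [h1]
    rw [lintegral_const_mul _ (by fun_prop), ← hmgf, ← mul_assoc,
      ← ENNReal.ofReal_mul (Real.exp_pos _).le,
      ← ENNReal.ofReal_mul (by positivity), ← Real.exp_add, ← Real.exp_add]
    congr 2
    rw [hs2, hα]; field_simp; ring
  -- completing the square turns the averaged bound into a Gaussian density of variance `1 + u`
  have hgauss : ∀ g : ℝ, gaussianPDF 0 1 g * ENNReal.ofReal (Real.exp (c * (α + s * g) ^ 2 / 2)) =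
      ENNReal.ofReal (K⁻¹) * gaussianPDF (b * s) v g := by
    intro g
    rw [gaussianPDF, gaussianPDF, ← ENNReal.ofReal_mul (gaussianPDFReal_nonneg _ _ _),
      ← ENNReal.ofReal_mul (by positivity), gaussianPDFReal, gaussianPDFReal, hvr]
    congr 1
    have h1 : √(2 * Real.pi * (1 + u)) = √(2 * Real.pi) * Real.exp (Real.log (1 + u) / 2) := by
      rw [Real.sqrt_mul (by positivity), Real.sqrt_eq_rpow (1 + u),
        Real.rpow_def_of_pos (by positivity)]
      congr 2; ring
    rw [h1, hK, ← Real.exp_neg, mul_inv, ← Real.exp_neg, NNReal.coe_one, mul_one]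
    have h2 : ∀ A B C D E F : ℝ, A + B = C + (D + E) →
        F * Real.exp A * Real.exp B = Real.exp C * (F * Real.exp D * Real.exp E) := by
      intro A B C D E F h
      rw [mul_assoc, ← Real.exp_add, h, Real.exp_add, Real.exp_add]; ring
    refine h2 _ _ _ _ _ _ ?_
    have h3 : c * (α + s * g) ^ 2 / 2 = c * α ^ 2 / 2 + c * α * s * g + c * s ^ 2 * g ^ 2 / 2 := by
      ring
    have h4 : (g - b * s) ^ 2 = g ^ 2 - 2 * b * s * g + b ^ 2 * s ^ 2 := by ring
    rw [h3, h4, hs2, hα]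
    field_simp
    ring
  have hmeas : Measurable fun p : Ω × ℝ => ENNReal.ofReal (Real.exp ((α + s * p.2) * X p.1)) := by
    fun_prop
  calc _ = ENNReal.ofReal K * ∫⁻ ω, ∫⁻ g, ENNReal.ofReal (Real.exp ((α + s * g) * X ω))
        ∂(gaussianReal 0 1) ∂P := by
        simp_rw [hsplit]
        rw [lintegral_const_mul]
        exact hmeas.lintegral_prod_right'
    _ = ENNReal.ofReal K * ∫⁻ g, ∫⁻ ω, ENNReal.ofReal (Real.exp ((α + s * g) * X ω)) ∂P
        ∂(gaussianReal 0 1) := by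
        rw [lintegral_lintegral_swap hmeas.aemeasurable]
    _ ≤ ENNReal.ofReal K * ∫⁻ g, ENNReal.ofReal (Real.exp (c * (α + s * g) ^ 2 / 2))
        ∂(gaussianReal 0 1) := by
        gcongr with g
        exact hsub _
    _ = ENNReal.ofReal K * ∫⁻ g, ENNReal.ofReal (K⁻¹) * gaussianPDF (b * s) v g := by
        rw [gaussianReal_of_var_ne_zero _ one_ne_zero,
          lintegral_withDensity_eq_lintegral_mul _ (measurable_gaussianPDF _ _) (by fun_prop)]
        simp only [Pi.mul_apply, hgauss]
    _ = 1 := by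
        rw [lintegral_const_mul _ (measurable_gaussianPDF _ _), lintegral_gaussianPDF_eq_one _ hv0,
          mul_one, ← ENNReal.ofReal_mul (Real.exp_pos _).le, mul_inv_cancel₀ (Real.exp_pos _).ne',
          ENNReal.ofReal_one]

/-- Averaging out a factor whose randomness is independent of the past. -/
lemma lintegral_mul_le_of_indep {Ω : Type*} {m mΩ : MeasurableSpace Ω} {P : Measure Ω}
    [IsProbabilityMeasure P] (hm : m ≤ mΩ) {E : Type*} [MeasurableSpace E]
    {W : Ω → ℝ≥0∞} (hW : Measurable[m] W) {Y : Ω → E}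
    (hY : Measurable[m] Y) {X : Ω → ℝ} (hX : Measurable X)
    (hind : Indep (MeasurableSpace.comap X inferInstance) m P) {F : E → ℝ → ℝ≥0∞}
    (hF : Measurable (Function.uncurry F))
    (hint : ∀ y ∈ Set.range Y, ∫⁻ ω, F y (X ω) ∂P ≤ 1) :
    ∫⁻ ω, W ω * F (Y ω) (X ω) ∂P ≤ ∫⁻ ω, W ω ∂P := by
  have hW' : Measurable W := hW.mono hm le_rfl
  have hY' : Measurable Y := hY.mono hm le_rfl
  have hWY : Measurable fun ω => (W ω, Y ω) := hW'.prodMk hY'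
  have hindf : IndepFun (fun ω => (W ω, Y ω)) X P := by
    refine Indep.symm (indep_of_indep_of_le_right hind ?_)
    exact (hW.prodMk hY).comap_le
  have hprod := (indepFun_iff_map_prod_eq_prod_map_map hWY.aemeasurable hX.aemeasurable).1 hindf
  have hH : Measurable fun q : (ℝ≥0∞ × E) × ℝ => q.1.1 * F q.1.2 q.2 :=
    (measurable_fst.comp measurable_fst).mul
      (hF.comp ((measurable_snd.comp measurable_fst).prodMk measurable_snd))
  calc _ = ∫⁻ q, q.1.1 * F q.1.2 q.2 ∂(P.map fun ω => ((W ω, Y ω), X ω)) := by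
        rw [lintegral_map hH (hWY.prodMk hX)]
    _ = ∫⁻ ω, ∫⁻ ω', W ω * F (Y ω) (X ω') ∂P ∂P := by
        rw [hprod, lintegral_prod _ hH.aemeasurable, lintegral_map hH.lintegral_prod_right' hWY]
        refine lintegral_congr fun ω => ?_
        exact lintegral_map (hH.comp measurable_prodMk_left) hX
    _ ≤ _ := by
        refine lintegral_mono fun ω => ?_
        have hFm : Measurable fun ω' => F (Y ω) (X ω') :=
          hF.comp (measurable_const.prodMk hX)
        simp only
        rw [lintegral_const_mul _ hFm]
        exact mul_le_of_le_one_right' (hint _ ⟨ω, rfl⟩)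

/-- Ville's maximal inequality for nonnegative supermartingales. -/
lemma mul_measure_exists_le (𝓕 : Filtration ℕ mΩ) {Z : ℕ → Ω → ℝ≥0∞}
    (hZ : ∀ t, Measurable[𝓕 t] (Z t))
    (hstep : ∀ t A, MeasurableSet[𝓕 t] A → ∫⁻ ω in A, Z (t + 1) ω ∂P ≤ ∫⁻ ω in A, Z t ω ∂P)
    (c : ℝ≥0∞) : c * P {ω | ∃ t, c ≤ Z t ω} ≤ ∫⁻ ω, Z 0 ω ∂P := by
  set A : ℕ → Set Ω := fun t => {ω | ∃ s < t, c ≤ Z s ω} with hA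
  have hAmeas : ∀ t, MeasurableSet[𝓕 t] (A t) := by
    intro t
    have : A t = ⋃ s ∈ Finset.range t, {ω | c ≤ Z s ω} := by ext ω; simp [hA]
    rw [this]
    refine Finset.measurableSet_biUnion _ fun s hs => ?_
    exact 𝓕.mono (Finset.mem_range.1 hs).le _ (measurableSet_le measurable_const (hZ s))
  have hAmono : Monotone A := fun s t hst ω ⟨r, hr, h⟩ => ⟨r, hr.trans_le hst, h⟩
  have hfin : ∀ t, c * P (A t) + ∫⁻ ω in (A t)ᶜ, Z t ω ∂P ≤ ∫⁻ ω, Z 0 ω ∂P := by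
    intro t
    induction t with
    | zero => simp [hA]
    | succ t ih =>
      refine le_trans ?_ ih
      set D : Set Ω := {ω | c ≤ Z t ω} with hD
      have hDm : MeasurableSet D := 𝓕.le t _ (measurableSet_le measurable_const (hZ t))
      have hAs : A (t + 1) = A t ∪ ((A t)ᶜ ∩ D) := by
        ext ω
        simp only [hA, hD, Set.mem_ofPred_eq, Set.mem_union, Set.mem_inter_iff, Set.mem_compl_iff,
          Nat.lt_succ_iff_lt_or_eq]
        constructor
        · rintro ⟨s, hs | rfl, h⟩
          · exact Or.inl ⟨s, hs, h⟩
          · by_cases h' : ∃ r < s, c ≤ Z r ω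
            · exact Or.inl h'
            · exact Or.inr ⟨h', h⟩
        · rintro (⟨s, hs, h⟩ | ⟨_, h⟩)
          · exact ⟨s, Or.inl hs, h⟩
          · exact ⟨t, Or.inr rfl, h⟩
      have hAc : (A (t + 1))ᶜ = (A t)ᶜ \ D := by
        rw [hAs]; ext ω; simp; tauto
      have h1 : ∫⁻ ω in (A (t + 1))ᶜ, Z (t + 1) ω ∂P ≤ ∫⁻ ω in (A t)ᶜ \ D, Z t ω ∂P := by
        rw [hAc]
        refine hstep t _ ((hAmeas t).compl.diff ?_)
        exact measurableSet_le measurable_const (hZ t)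
      have h2 : c * P ((A t)ᶜ ∩ D) ≤ ∫⁻ ω in (A t)ᶜ ∩ D, Z t ω ∂P := by
        rw [← setLIntegral_const]
        exact setLIntegral_mono' ((𝓕.le t _ (hAmeas t)).compl.inter hDm) fun ω hω => hω.2
      calc c * P (A (t + 1)) + ∫⁻ ω in (A (t + 1))ᶜ, Z (t + 1) ω ∂P
          ≤ c * (P (A t) + P ((A t)ᶜ ∩ D)) + ∫⁻ ω in (A t)ᶜ \ D, Z t ω ∂P := by
            rw [hAs] at h1 ⊢
            gcongr
            exact measure_union_le _ _
        _ ≤ c * P (A t) + (∫⁻ ω in (A t)ᶜ ∩ D, Z t ω ∂P + ∫⁻ ω in (A t)ᶜ \ D, Z t ω ∂P) := by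
            rw [mul_add, add_assoc]
            gcongr
        _ = _ := by rw [lintegral_inter_add_sdiff _ _ hDm]
  have hU : {ω | ∃ t, c ≤ Z t ω} = ⋃ t, A t := by
    ext ω
    simp only [hA, Set.mem_ofPred_eq, Set.mem_iUnion]
    exact ⟨fun ⟨t, h⟩ => ⟨t + 1, t, Nat.lt_succ_self t, h⟩, fun ⟨t, s, _, h⟩ => ⟨s, h⟩⟩
  rw [hU, hAmono.measure_iUnion, ENNReal.mul_iSup]
  exact iSup_le fun t => le_trans le_self_add (hfin t)

open Matrix in
/-- The method of mixtures: the exponentiated self-normalized sum, corrected by the determinant of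
the regularized Gram matrix, is a nonnegative supermartingale, so with high probability it stays
bounded at all times simultaneously. -/
theorem measure_selfNorm_ge_le [IsProbabilityMeasure P] {ι : Type*} [Fintype ι] [DecidableEq ι]
    (𝓕 : Filtration ℕ mΩ) {ψ : ℕ → Ω → ι → ℝ} (hψ : ∀ t, Measurable[𝓕 t] (ψ t))
    {ε : ℕ → Ω → ℝ} (hε : ∀ t, Measurable[𝓕 (t + 1)] (ε t))
    (hind : ∀ t, Indep (MeasurableSpace.comap (ε t) inferInstance) (𝓕 t) P)
    {σ : ℝ≥0} (hσ : 0 < σ) (hsub : ∀ t, HasSubgaussianMGF (ε t) (σ ^ 2) P)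
    {ρ : ℝ} (hρ : 0 < ρ) (c : ℝ) :
    P {ω | ∃ t, σ ^ 2 * (Real.log (regGram ρ (fun s => ψ s ω) t).det -
        Fintype.card ι * Real.log ρ + 2 * c) ≤ selfNorm ρ (fun s => ψ s ω) (fun s => ε s ω) t} ≤
      ENNReal.ofReal (Real.exp (-c)) := by
  have hσ2 : (0 : ℝ≥0) < σ ^ 2 := by positivity
  have hσr : (0 : ℝ) < (σ : ℝ) ^ 2 := by exact_mod_cast hσ2
  set Z : ℕ → Ω → ℝ≥0∞ := fun t ω => ENNReal.ofReal (Real.exp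
    ((selfNorm ρ (fun s => ψ s ω) (fun s => ε s ω) t / (σ : ℝ) ^ 2 -
      Real.log (regGram ρ (fun s => ψ s ω) t).det + Fintype.card ι * Real.log ρ) / 2)) with hZ
  have hψ' : ∀ t, ∀ s ≤ t, Measurable[𝓕 t] (ψ s) := fun t s h => (hψ s).mono (𝓕.mono h) le_rfl
  have hε' : ∀ t, ∀ s < t, Measurable[𝓕 t] (ε s) := fun t s h => (hε s).mono (𝓕.mono h) le_rfl
  have hZm : ∀ t, Measurable[𝓕 t] (Z t) := by
    intro t
    have h1 := measurable_selfNorm (m := 𝓕 t) ρ (fun s hs => hψ' t s hs.le) (hε' t)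
    have h2 := measurable_det (m := 𝓕 t) (measurable_regGram ρ (fun s hs => hψ' t s hs.le))
    exact ENNReal.measurable_ofReal.comp (Real.measurable_exp.comp
      ((((h1.div_const _).sub (Real.measurable_log.comp h2)).add_const _).div_const _))
  have hstep : ∀ t A, MeasurableSet[𝓕 t] A →
      ∫⁻ ω in A, Z (t + 1) ω ∂P ≤ ∫⁻ ω in A, Z t ω ∂P := by
    intro t A hA
    have hA' := 𝓕.le t _ hA
    rw [← lintegral_indicator hA', ← lintegral_indicator hA']
    set Y : Ω → ℝ × ℝ := fun ω =>
      (ψ t ω ⬝ᵥ (regGram ρ (fun s => ψ s ω) t)⁻¹ *ᵥ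
          noiseSum (fun s => ψ s ω) (fun s => ε s ω) t,
        ψ t ω ⬝ᵥ (regGram ρ (fun s => ψ s ω) t)⁻¹ *ᵥ ψ t ω) with hY
    have hYm : Measurable[𝓕 t] Y := by
      have hinv := measurable_inv_apply (m := 𝓕 t)
        (measurable_regGram (t := t) ρ (fun s hs => hψ' t s hs.le))
      exact (measurable_dotProduct (hψ t) (measurable_mulVec hinv
        (measurable_noiseSum (fun s hs => hψ' t s hs.le) (hε' t)))).prodMk
        (measurable_dotProduct (hψ t) (measurable_mulVec hinv (hψ t)))
    set F : ℝ × ℝ → ℝ → ℝ≥0∞ := fun y e => ENNReal.ofReal (Real.exp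
      (((2 * y.1 * e + y.2 * e ^ 2 - y.1 ^ 2) / (1 + y.2) / (σ ^ 2 : ℝ≥0)
        - Real.log (1 + y.2)) / 2)) with hF
    have hFm : Measurable (Function.uncurry F) := by
      simp only [hF, Function.uncurry_def]
      fun_prop
    have hZsucc : ∀ ω, Z (t + 1) ω = Z t ω * F (Y ω) (ε t ω) := by
      intro ω
      simp only [hZ, hF, hY]
      rw [← ENNReal.ofReal_mul (Real.exp_pos _).le, ← Real.exp_add, selfNorm_succ hρ,
        log_det_regGram_succ hρ]
      congr 2
      push_cast
      ring
    have hind' : ∀ ω, A.indicator (Z (t + 1)) ω = A.indicator (Z t) ω * F (Y ω) (ε t ω) := by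
      intro ω
      by_cases h : ω ∈ A <;> simp [h, hZsucc]
    simp_rw [hind']
    refine lintegral_mul_le_of_indep (𝓕.le t) ((hZm t).indicator hA) hYm
      ((hε t).mono (𝓕.le _) le_rfl) (hind t) hFm ?_
    rintro _ ⟨ω, rfl⟩
    exact lintegral_exp_quadratic_le ((hε t).mono (𝓕.le _) le_rfl) hσ2 (hsub t) _
      (quadForm_nonneg (regGram_posDef hρ _ t).inv _)
  have hville := mul_measure_exists_le 𝓕 hZm hstep (ENNReal.ofReal (Real.exp c))
  have hZ0 : ∫⁻ ω, Z 0 ω ∂P = 1 := by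
    simp [hZ, selfNorm_zero, log_det_regGram_zero]
  rw [hZ0] at hville
  have hsub' : {ω | ∃ t, σ ^ 2 * (Real.log (regGram ρ (fun s => ψ s ω) t).det -
        Fintype.card ι * Real.log ρ + 2 * c) ≤ selfNorm ρ (fun s => ψ s ω) (fun s => ε s ω) t} ⊆
      {ω | ∃ t, ENNReal.ofReal (Real.exp c) ≤ Z t ω} := by
    rintro ω ⟨t, ht⟩
    refine ⟨t, ENNReal.ofReal_le_ofReal (Real.exp_le_exp.2 ?_)⟩
    rw [mul_comm, ← le_div_iff₀ hσr] at ht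
    linarith
  refine (measure_mono hsub').trans ?_
  rw [Real.exp_neg, ENNReal.ofReal_inv_of_pos (Real.exp_pos c)]
  rw [ENNReal.le_inv_iff_mul_le, mul_comm]
  exact hville

end Maximal

/-! ### Almost sure growth of self-normalized sums -/

section Growth

open Matrix

variable {ι : Type*} [Fintype ι]

lemma sq_dotProduct_le_mul (a b : ι → ℝ) : (a ⬝ᵥ b) ^ 2 ≤ (a ⬝ᵥ a) * (b ⬝ᵥ b) := by
  simpa [dotProduct, sq] using Finset.sum_mul_sq_le_sq_mul_sq Finset.univ a b

variable [DecidableEq ι]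

lemma regGram_quadForm_le {ρ κ : ℝ} {ψ : ℕ → ι → ℝ} (hκ : ∀ s, ψ s ⬝ᵥ ψ s ≤ κ) (t : ℕ)
    (w : ι → ℝ) : w ⬝ᵥ regGram ρ ψ t *ᵥ w ≤ (ρ + κ * t) * (w ⬝ᵥ w) := by
  have hw : 0 ≤ w ⬝ᵥ w := by simpa using dotProduct_star_self_nonneg w
  rw [regGram_quadForm, add_mul]
  gcongr
  calc ∑ s ∈ Finset.range t, (ψ s ⬝ᵥ w) ^ 2 ≤ ∑ s ∈ Finset.range t, κ * (w ⬝ᵥ w) :=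
        Finset.sum_le_sum fun s _ => (sq_dotProduct_le_mul _ _).trans
          (mul_le_mul_of_nonneg_right (hκ s) hw)
    _ = _ := by simp; ring

lemma log_det_regGram_le [Nonempty ι] {ρ κ : ℝ} (hρ : 0 < ρ) (hκ0 : 0 ≤ κ) {ψ : ℕ → ι → ℝ}
    (hκ : ∀ s, ψ s ⬝ᵥ ψ s ≤ κ) (t : ℕ) :
    Real.log (regGram ρ ψ t).det ≤ Fintype.card ι * Real.log (ρ + κ * t) := by
  refine log_det_le_of_trace_le (regGram_posDef hρ ψ t) (by positivity) ?_
  rw [regGram_trace, mul_add, mul_comm ρ]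
  gcongr
  have h1 : (1 : ℝ) ≤ Fintype.card ι := by exact_mod_cast Fintype.card_pos
  calc ∑ s ∈ Finset.range t, ψ s ⬝ᵥ ψ s ≤ ∑ s ∈ Finset.range t, κ :=
        Finset.sum_le_sum fun s _ => hκ s
    _ = κ * t := by simp [mul_comm]
    _ ≤ _ := le_mul_of_one_le_left (by positivity) h1

lemma tendsto_log_natCast : Tendsto (fun t : ℕ => Real.log t) atTop atTop :=
  Real.tendsto_log_atTop.comp tendsto_natCast_atTop_atTop

/-- Pathwise growth of the self-normalized sum. If the design is not spread out in all directions,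
the determinant is small and the bound for the regularization `ρ` suffices. Otherwise the Gram
matrix dominates `2 ^ k I ≈ √t I`, so the regularization can be raised to `2 ^ k` at the
cost of a constant factor, which halves the logarithm of the normalized determinant. -/
lemma eventually_selfNorm_le [Nonempty ι] {ρ κ K v : ℝ} (hρ : 0 < ρ) (hκ0 : 0 ≤ κ) (hv : 0 ≤ v)
    {ψ : ℕ → ι → ℝ} {ε : ℕ → ℝ} (hκ : ∀ s, ψ s ⬝ᵥ ψ s ≤ κ)
    (h1 : ∀ t, selfNorm ρ ψ ε t ≤ v * (Real.log (regGram ρ ψ t).det -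
      Fintype.card ι * Real.log ρ + K))
    (h2 : ∀ᶠ k : ℕ in atTop, ∀ t, selfNorm (2 ^ k) ψ ε t ≤
      v * (Real.log (regGram (2 ^ k) ψ t).det -
        Fintype.card ι * Real.log (2 ^ k) + 4 * Real.log (k + 1))) :
    ∀ᶠ t : ℕ in atTop, selfNorm ρ ψ ε t ≤ v * ((Fintype.card ι - 1 / 8) * Real.log t) := by
  set d : ℝ := (Fintype.card ι : ℝ) with hd
  have hd1 : (1 : ℝ) ≤ d := by rw [hd]; exact_mod_cast Fintype.card_pos
  have hk : Tendsto (fun t : ℕ => Nat.log 4 t) atTop atTop := by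
    refine tendsto_atTop.2 fun b => ?_
    filter_upwards [eventually_ge_atTop (4 ^ b)] with t ht
    exact Nat.le_log_of_pow_le (by norm_num) ht
  have hloglog : ∀ᶠ x : ℝ in atTop, 6 * Real.log (x + 1) ≤ x / 16 := by
    have := (Real.isLittleO_log_id_atTop.bound (c := 1 / 192) (by norm_num))
    have h' := (tendsto_atTop_add_const_right atTop (1 : ℝ) tendsto_id).eventually this
    filter_upwards [h', eventually_ge_atTop 1] with x hx hx1
    simp only [id, Real.norm_eq_abs] at hx
    rw [abs_of_nonneg (by linarith : (0 : ℝ) ≤ x + 1)] at hx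
    have := le_abs_self (Real.log (x + 1))
    linarith
  filter_upwards [hk.eventually h2, eventually_ge_atTop 1, tendsto_log_natCast.eventually hloglog,
    tendsto_log_natCast.eventually_ge_atTop (8 * (K - d * Real.log ρ)),
    tendsto_log_natCast.eventually_ge_atTop (4 * (Real.log 2 + (d - 1) * Real.log (ρ + κ))),
    tendsto_log_natCast.eventually_ge_atTop (24 * Real.log (1 + 2 * κ))]
    with t hq ht hll hA hB hC
  set Lt := Real.log t with hL
  have ht1 : (1 : ℝ) ≤ t := by exact_mod_cast ht
  have hL0 : 0 ≤ Lt := Real.log_nonneg ht1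
  set k := Nat.log 4 t with hkdef
  by_cases hcase : Real.log (regGram ρ ψ t).det ≤ (d - 1 / 4) * Lt
  · refine (h1 t).trans (mul_le_mul_of_nonneg_left ?_ hv)
    linarith
  · push Not at hcase
    have hsqrt : (√(t : ℝ)) ^ 2 = t := Real.sq_sqrt (by positivity)
    have hk1 : (2 : ℝ) ^ k ≤ √t := by
      rw [Real.le_sqrt (by positivity) (by positivity), ← pow_mul, mul_comm, pow_mul]
      have : 4 ^ k ≤ t := Nat.pow_log_le_self 4 (by omega)
      norm_num
      exact_mod_cast this
    have hk2 : √t ≤ 2 * 2 ^ k := by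
      rw [Real.sqrt_le_left (by positivity), mul_pow, ← pow_mul, mul_comm k, pow_mul]
      have : t < 4 ^ (k + 1) := Nat.lt_pow_succ_log_self (by norm_num) t
      have h4 : (t : ℝ) ≤ 4 ^ (k + 1) := by exact_mod_cast this.le
      rw [pow_succ] at h4
      norm_num
      linarith
    have hlogsqrt : Real.log √t = Lt / 2 := Real.log_sqrt (by positivity)
    have hG := regGram_posDef hρ ψ t
    have hpow := regGram_posDef (ρ := 2 ^ k) (by positivity) ψ t
    -- the least eigenvalue of the Gram matrix is at least `2 ^ (k + 1)`
    have hmin : ∀ w : ι → ℝ, 2 * 2 ^ k * (w ⬝ᵥ w) ≤ w ⬝ᵥ regGram ρ ψ t *ᵥ w := by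
      intro w
      have hΛ : 0 < ρ + κ * t := by positivity
      have hdet := det_mul_dotProduct_le hG (regGram_quadForm_le hκ t) w
      have hpos : 0 < (ρ + κ * t) ^ (Fintype.card ι - 1) := by positivity
      have hge : (ρ + κ * t) ^ (Fintype.card ι - 1) * (2 * 2 ^ k) ≤ (regGram ρ ψ t).det := by
        rw [← Real.log_le_log_iff (by positivity) hG.det_pos, Real.log_mul hpos.ne' (by positivity),
          Real.log_mul (by norm_num) (by positivity), Real.log_pow,
          Nat.cast_sub Fintype.card_pos, Nat.cast_one, ← hd]
        have e1 : Real.log (2 ^ k) ≤ Lt / 2 := by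
          rw [← hlogsqrt]; exact Real.log_le_log (by positivity) hk1
        have e2 : Real.log (ρ + κ * t) ≤ Real.log (ρ + κ) + Lt := by
          rw [hL, ← Real.log_mul (by positivity) (by positivity)]
          refine Real.log_le_log hΛ ?_
          nlinarith
        have e3 : (d - 1) * Real.log (ρ + κ * t) ≤ (d - 1) * (Real.log (ρ + κ) + Lt) :=
          mul_le_mul_of_nonneg_left e2 (by linarith)
        linarith
      have hw : 0 ≤ w ⬝ᵥ w := by simpa using dotProduct_star_self_nonneg w
      refine le_of_mul_le_mul_left ?_ hpos
      calc _ = ((ρ + κ * t) ^ (Fintype.card ι - 1) * (2 * 2 ^ k)) * (w ⬝ᵥ w) := by ring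
        _ ≤ (regGram ρ ψ t).det * (w ⬝ᵥ w) := by gcongr
        _ ≤ _ := hdet
    have hcomp : selfNorm ρ ψ ε t ≤ 3 / 2 * selfNorm (2 ^ k) ψ ε t := by
      refine inv_quadForm_le hpow hG (fun w => ?_) _
      have e1 := hmin w
      have hw : 0 ≤ w ⬝ᵥ w := by simpa using dotProduct_star_self_nonneg w
      rw [regGram_quadForm] at e1 ⊢
      rw [regGram_quadForm]
      nlinarith [mul_nonneg hρ.le hw]
    have hdetk : Real.log (regGram (2 ^ k) ψ t).det - d * Real.log (2 ^ k) ≤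
        d * (Real.log (1 + 2 * κ) + Lt / 2) := by
      have e1 := log_det_regGram_le (ρ := 2 ^ k) (by positivity) hκ0 hκ t
      rw [← hd] at e1
      have e2 : Real.log (2 ^ k + κ * t) ≤
          Real.log (1 + 2 * κ) + Lt / 2 + Real.log (2 ^ k) := by
        rw [← hlogsqrt, ← Real.log_mul (by positivity) (by positivity),
          ← Real.log_mul (by positivity) (by positivity)]
        refine Real.log_le_log (by positivity) ?_
        have hs1 : 1 ≤ √(t : ℝ) := Real.one_le_sqrt.2 ht1
        have e3 : κ * t ≤ 2 * κ * √t * 2 ^ k := by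
          calc κ * t = κ * √t * √t := by rw [mul_assoc, ← sq, hsqrt]
            _ ≤ κ * √t * (2 * 2 ^ k) := by gcongr
            _ = _ := by ring
        have e4 : (2 : ℝ) ^ k ≤ √t * 2 ^ k := le_mul_of_one_le_left (by positivity) hs1
        linarith
      have e5 := mul_le_mul_of_nonneg_left e2 (by linarith : 0 ≤ d)
      linarith
    have hklog : Real.log (k + 1) ≤ Real.log (Lt + 1) := by
      refine Real.log_le_log (by positivity) ?_
      have e1 : (k : ℝ) * Real.log 4 ≤ Lt := by
        rw [← Real.log_pow]
        refine Real.log_le_log (by positivity) ?_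
        exact_mod_cast Nat.pow_log_le_self 4 (by omega : t ≠ 0)
      have e2 : (1 : ℝ) ≤ Real.log 4 := by
        rw [Real.le_log_iff_exp_le (by norm_num)]
        linarith [Real.exp_one_lt_d9]
      have : (k : ℝ) ≤ k * Real.log 4 := le_mul_of_one_le_right (by positivity) e2
      linarith
    have hq' := hq t
    calc selfNorm ρ ψ ε t ≤ 3 / 2 * selfNorm (2 ^ k) ψ ε t := hcomp
      _ ≤ 3 / 2 * (v * (d * (Real.log (1 + 2 * κ) + Lt / 2) + 4 * Real.log (Lt + 1))) := by
          refine mul_le_mul_of_nonneg_left (hq'.trans ?_) (by norm_num)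
          gcongr
      _ = v * (3 / 2 * (d * (Real.log (1 + 2 * κ) + Lt / 2) + 4 * Real.log (Lt + 1))) := by ring
      _ ≤ _ := by
          refine mul_le_mul_of_nonneg_left ?_ hv
          have e1 : d * (24 * Real.log (1 + 2 * κ)) ≤ d * Lt := by gcongr
          have e2 : Lt ≤ d * Lt := le_mul_of_one_le_left hL0 hd1
          nlinarith

/-- Almost surely, the self-normalized sum in dimension `d` eventually stays below
`σ² (d - 1/8) log t`, whatever the adaptively chosen design. -/
theorem ae_eventually_selfNorm_le [Nonempty ι] {Ω : Type*} {mΩ : MeasurableSpace Ω}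
    {P : Measure Ω} [IsProbabilityMeasure P]
    (𝓕 : Filtration ℕ mΩ) {ψ : ℕ → Ω → ι → ℝ} (hψ : ∀ t, Measurable[𝓕 t] (ψ t))
    {ε : ℕ → Ω → ℝ} (hε : ∀ t, Measurable[𝓕 (t + 1)] (ε t))
    (hind : ∀ t, Indep (MeasurableSpace.comap (ε t) inferInstance) (𝓕 t) P)
    {σ : ℝ≥0} (hσ : 0 < σ) (hsub : ∀ t, HasSubgaussianMGF (ε t) (σ ^ 2) P)
    {ρ κ : ℝ} (hρ : 0 < ρ) (hκ0 : 0 ≤ κ) (hκ : ∀ s ω, ψ s ω ⬝ᵥ ψ s ω ≤ κ) :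
    ∀ᵐ ω ∂P, ∀ᶠ t : ℕ in atTop, selfNorm ρ (fun s => ψ s ω) (fun s => ε s ω) t ≤
      (σ : ℝ) ^ 2 * ((Fintype.card ι - 1 / 8) * Real.log t) := by
  have h1 : ∀ᵐ ω ∂P, ∃ N : ℕ, ∀ t, selfNorm ρ (fun s => ψ s ω) (fun s => ε s ω) t ≤
      (σ : ℝ) ^ 2 * (Real.log (regGram ρ (fun s => ψ s ω) t).det -
        Fintype.card ι * Real.log ρ + 2 * N) := by
    rw [ae_iff]
    have hle : ∀ N : ℕ, P {ω | ¬ ∃ N : ℕ, ∀ t, selfNorm ρ (fun s => ψ s ω) (fun s => ε s ω) t ≤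
        (σ : ℝ) ^ 2 * (Real.log (regGram ρ (fun s => ψ s ω) t).det -
        Fintype.card ι * Real.log ρ + 2 * N)} ≤ ENNReal.ofReal (Real.exp (-(N : ℝ))) := by
      intro N
      refine (measure_mono fun ω hω => ?_).trans
        (measure_selfNorm_ge_le 𝓕 hψ hε hind hσ hsub hρ N)
      simp only [Set.mem_ofPred_eq, not_exists, not_forall, not_le] at hω ⊢
      obtain ⟨t, ht⟩ := hω N
      exact ⟨t, ht.le⟩
    have hlim : Tendsto (fun N : ℕ => ENNReal.ofReal (Real.exp (-(N : ℝ)))) atTop (𝓝 0) := by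
      rw [← ENNReal.ofReal_zero]
      exact ENNReal.tendsto_ofReal (Real.tendsto_exp_neg_atTop_nhds_zero.comp
        tendsto_natCast_atTop_atTop)
    exact le_antisymm (ge_of_tendsto' hlim hle) zero_le
  have h2 : ∀ᵐ ω ∂P, ∀ᶠ k : ℕ in atTop, ∀ t,
      selfNorm (2 ^ k) (fun s => ψ s ω) (fun s => ε s ω) t ≤
      (σ : ℝ) ^ 2 * (Real.log (regGram (2 ^ k) (fun s => ψ s ω) t).det -
        Fintype.card ι * Real.log (2 ^ k) + 4 * Real.log (k + 1)) := by
    have hsum : ∑' k : ℕ, P {ω | ∃ t, (σ : ℝ) ^ 2 * (Real.log (regGram (2 ^ k)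
        (fun s => ψ s ω) t).det - Fintype.card ι * Real.log (2 ^ k) +
        2 * (2 * Real.log (k + 1))) ≤
        selfNorm (2 ^ k) (fun s => ψ s ω) (fun s => ε s ω) t} ≠ ∞ := by
      refine ne_top_of_le_ne_top ?_ (ENNReal.tsum_le_tsum fun k =>
        measure_selfNorm_ge_le 𝓕 hψ hε hind hσ hsub (ρ := 2 ^ k) (by positivity)
          (2 * Real.log (k + 1)))
      refine Summable.tsum_ofReal_ne_top ?_
      have hs := (summable_nat_add_iff 1).2 (Real.summable_one_div_nat_pow.2 one_lt_two)
      refine hs.congr fun k => ?_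
      have hk : (0 : ℝ) < k + 1 := by positivity
      rw [Real.exp_neg, mul_comm, Real.exp_mul, Real.exp_log hk]
      push_cast
      rw [one_div]
      norm_cast
    filter_upwards [ae_eventually_notMem hsum] with ω hω
    filter_upwards [hω] with k hk t
    simp only [not_exists, not_le] at hk
    have := (hk t).le
    rwa [← mul_assoc, show (2 : ℝ) * 2 = 4 by norm_num] at this
  filter_upwards [h1, h2] with ω ⟨N, hN⟩ hω
  exact eventually_selfNorm_le hρ hκ0 (by positivity) (fun s => hκ s ω) hN hω

end Growth

/-! ### Gaussian process posteriors for kernels with finitely many features -/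

section Posterior

open Matrix

variable {X ι : Type*} [Fintype ι]

lemma gram_posDef {Ψ : X → ι → ℝ} {D : ι → ℝ} (hD : ∀ q, 0 ≤ D q) {k : X → X → ℝ}
    (hk : ∀ x x', k x x' = ∑ q, D q * (Ψ x q * Ψ x' q)) {v : ℝ} (hv : 0 < v) (t : ℕ)
    (x : ℕ → X) : (gram k v t x).PosDef := by
  set B : Matrix (Fin t) ι ℝ := Matrix.of fun i q => √(D q) * Ψ (x i) q with hB
  have hBB : (Matrix.of fun i j : Fin t => k (x i) (x j)) = B * Bᴴ := by
    ext i j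
    simp only [hB, Matrix.of_apply, Matrix.mul_apply, conjTranspose_apply, star_trivial, hk]
    refine Finset.sum_congr rfl fun q _ => ?_
    rw [mul_mul_mul_comm, Real.mul_self_sqrt (hD q)]
  rw [gram, hBB]
  exact (PosDef.one.smul hv).posSemidef_add (posSemidef_self_mul_conjTranspose B)

/-- The posterior at `z` is governed by a vector `w`, the regularized least squares solution of the
dual problem: it gives the posterior variance, and it splits the error of the posterior mean into a
noise term and a bias term. -/
lemma exists_posterior_representer {Ψ : X → ι → ℝ} {D : ι → ℝ} (hD : ∀ q, 0 < D q)
    {k : X → X → ℝ} (hk : ∀ x x', k x x' = ∑ q, D q * (Ψ x q * Ψ x' q)) {v : ℝ} (hv : 0 < v)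
    (t : ℕ) (x : ℕ → X) (θ : ι → ℝ) (ε : ℕ → ℝ) (z : X) :
    ∃ w : ι → ℝ, gpStd k v t x z = √(v * (w ⬝ᵥ Ψ z)) ∧
      w ⬝ᵥ Ψ z = ∑ q, v / D q * w q ^ 2 + ∑ s ∈ Finset.range t, (Ψ (x s) ⬝ᵥ w) ^ 2 ∧
      gpMean k v t x (fun s => θ ⬝ᵥ Ψ (x s) + ε s) z - θ ⬝ᵥ Ψ z =
        w ⬝ᵥ noiseSum (fun s => Ψ (x s)) ε t - ∑ q, θ q * (v / D q * w q) := by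
  have hK := gram_posDef (fun q => (hD q).le) hk hv t x
  set kz : Fin t → ℝ := fun i => k z (x i) with hkz
  set α : Fin t → ℝ := (gram k v t x)⁻¹ *ᵥ kz with hα
  have hKα : gram k v t x *ᵥ α = kz := mulVec_inv_mulVec hK kz
  set r : ι → ℝ := fun q => Ψ z q - ∑ i, α i * Ψ (x i) q with hr
  set w : ι → ℝ := fun q => D q * r q / v with hw
  have hcomm : ∀ a b, k a b = k b a := fun a b => by simp only [hk, mul_comm (Ψ a _)]
  -- evaluating the kernel against the residual feature vector
  have hker : ∀ a : X, v * (Ψ a ⬝ᵥ w) = k a z - ∑ i, α i * k a (x i) := by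
    intro a
    simp only [hk, dotProduct, hw, hr, Finset.mul_sum]
    rw [Finset.sum_comm, ← Finset.sum_sub_distrib]
    refine Finset.sum_congr rfl fun q _ => ?_
    have : ∑ i, α i * (D q * (Ψ a q * Ψ (x i) q)) = D q * Ψ a q * ∑ i, α i * Ψ (x i) q := by
      rw [Finset.mul_sum]; exact Finset.sum_congr rfl fun i _ => by ring
    rw [this]; field_simp
  have hF1 : ∀ i : Fin t, Ψ (x i) ⬝ᵥ w = α i := by
    intro i
    have h0 := hKα
    rw [gram, add_mulVec, smul_mulVec, one_mulVec] at h0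
    have h1 := congrFun h0 i
    have h2 := hker (x i)
    simp only [Pi.add_apply, Pi.smul_apply, smul_eq_mul, mulVec, dotProduct, Matrix.of_apply,
      hkz] at h1
    have h3 : ∑ j : Fin t, k (x i) (x j) * α j = ∑ j : Fin t, α j * k (x i) (x j) :=
      Finset.sum_congr rfl fun _ _ => mul_comm _ _
    rw [h3, hcomm z] at h1
    have h4 : v * (Ψ (x i) ⬝ᵥ w) = v * α i := by linarith
    exact mul_left_cancel₀ hv.ne' h4
  have hF2 : ∀ q, Ψ z q = v / D q * w q + ∑ i, α i * Ψ (x i) q := by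
    intro q
    simp only [hw, hr]
    have := (hD q).ne'
    field_simp
    ring
  refine ⟨w, ?_, ?_, ?_⟩
  · rw [gpStd, dotProduct_comm w, hker z]
    congr 2
    simp only [dotProduct, ← hkz, ← hα]
    exact Finset.sum_congr rfl fun i _ => mul_comm _ _
  · have h1 : w ⬝ᵥ Ψ z = ∑ q, v / D q * w q ^ 2 + ∑ i, α i * (Ψ (x i) ⬝ᵥ w) := by
      simp only [dotProduct, Finset.mul_sum]
      rw [Finset.sum_comm, ← Finset.sum_add_distrib]
      refine Finset.sum_congr rfl fun q _ => ?_
      conv_lhs => rw [hF2 q]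
      rw [mul_add, Finset.mul_sum]
      congr 1
      · ring
      · exact Finset.sum_congr rfl fun i _ => by ring
    rw [h1, Finset.sum_range fun s => (Ψ (x s) ⬝ᵥ w) ^ 2]
    simp only [hF1, sq]
  · have h1 : gpMean k v t x (fun s => θ ⬝ᵥ Ψ (x s) + ε s) z =
        ∑ i : Fin t, α i * (θ ⬝ᵥ Ψ (x i)) + ∑ i : Fin t, α i * ε i := by
      rw [gpMean, dotProduct_mulVec_comm hK.inv, ← hkz, ← hα, dotProduct,
        ← Finset.sum_add_distrib]
      exact Finset.sum_congr rfl fun i _ => by ring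
    have h2 : w ⬝ᵥ noiseSum (fun s => Ψ (x s)) ε t = ∑ i : Fin t, α i * ε i := by
      rw [noiseSum, dotProduct_sum, Finset.sum_range fun s => w ⬝ᵥ (ε s • Ψ (x s))]
      refine Finset.sum_congr rfl fun i _ => ?_
      rw [dotProduct_smul, dotProduct_comm, hF1, smul_eq_mul, mul_comm]
    have h3 : θ ⬝ᵥ Ψ z = ∑ q, θ q * (v / D q * w q) + ∑ i : Fin t, α i * (θ ⬝ᵥ Ψ (x i)) := by
      simp only [dotProduct, Finset.mul_sum]
      rw [Finset.sum_comm, ← Finset.sum_add_distrib]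
      refine Finset.sum_congr rfl fun q _ => ?_
      conv_lhs => rw [hF2 q]
      rw [mul_add, Finset.mul_sum]
      congr 1
      exact Finset.sum_congr rfl fun i _ => by ring
    rw [h1, h2, h3]; ring

/-- The posterior standard deviation in terms of the unweighted features, and the width of the
confidence interval: bias plus self-normalized noise. -/
lemma posterior_bounds [DecidableEq ι] {Ψ : X → ι → ℝ} {D : ι → ℝ} (hD : ∀ q, 0 < D q)
    {k : X → X → ℝ} (hk : ∀ x x', k x x' = ∑ q, D q * (Ψ x q * Ψ x' q)) {v : ℝ} (hv : 1 ≤ v)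
    {ρ : ℝ} (hρ : 0 < ρ) (hρD : ∀ q, ρ * D q ≤ 1) (t : ℕ) (x : ℕ → X) (θ : ι → ℝ) (ε : ℕ → ℝ)
    (z : X) :
    gpStd k v t x z ≤ √(v * (Ψ z ⬝ᵥ (regGram ρ (fun s => Ψ (x s)) t)⁻¹ *ᵥ Ψ z)) ∧
    |gpMean k v t x (fun s => θ ⬝ᵥ Ψ (x s) + ε s) z - θ ⬝ᵥ Ψ z| ≤
      (√(∑ q, θ q ^ 2 / D q) + √(selfNorm ρ (fun s => Ψ (x s)) ε t)) * gpStd k v t x z := by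
  have hv0 : 0 < v := by linarith
  obtain ⟨w, hstd, hwz, herr⟩ := exists_posterior_representer hD hk hv0 t x θ ε z
  have hG := regGram_posDef hρ (fun s => Ψ (x s)) t
  have hS : 0 ≤ ∑ s ∈ Finset.range t, (Ψ (x s) ⬝ᵥ w) ^ 2 :=
    Finset.sum_nonneg fun _ _ => sq_nonneg _
  have hB : 0 ≤ ∑ q, v / D q * w q ^ 2 :=
    Finset.sum_nonneg fun q _ => mul_nonneg (div_pos hv0 (hD q)).le (sq_nonneg _)
  have hs0 : 0 ≤ w ⬝ᵥ Ψ z := by rw [hwz]; positivity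
  have hwG : w ⬝ᵥ regGram ρ (fun s => Ψ (x s)) t *ᵥ w ≤ w ⬝ᵥ Ψ z := by
    rw [regGram_quadForm, hwz]
    gcongr
    rw [dotProduct, Finset.mul_sum]
    refine Finset.sum_le_sum fun q _ => ?_
    rw [← sq]
    gcongr
    rw [le_div_iff₀ (hD q)]
    exact (hρD q).trans hv
  have hsle : w ⬝ᵥ Ψ z ≤ v * (w ⬝ᵥ Ψ z) := le_mul_of_one_le_left hs0 hv
  have hquad : w ⬝ᵥ Ψ z ≤ Ψ z ⬝ᵥ (regGram ρ (fun s => Ψ (x s)) t)⁻¹ *ᵥ Ψ z := by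
    have h1 := sq_dotProduct_le hG w (Ψ z)
    have h2 : 0 ≤ Ψ z ⬝ᵥ (regGram ρ (fun s => Ψ (x s)) t)⁻¹ *ᵥ Ψ z := quadForm_nonneg hG.inv _
    rcases hs0.eq_or_lt with h | h
    · rwa [← h]
    · have h3 : (w ⬝ᵥ Ψ z) * (w ⬝ᵥ Ψ z) ≤
          (w ⬝ᵥ Ψ z) * (Ψ z ⬝ᵥ (regGram ρ (fun s => Ψ (x s)) t)⁻¹ *ᵥ Ψ z) := by
        rw [← sq]
        exact h1.trans (mul_le_mul_of_nonneg_right hwG h2)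
      exact le_of_mul_le_mul_left h3 h
  refine ⟨by rw [hstd]; gcongr, ?_⟩
  have hnoise : |w ⬝ᵥ noiseSum (fun s => Ψ (x s)) ε t| ≤
      √(selfNorm ρ (fun s => Ψ (x s)) ε t) * gpStd k v t x z := by
    rw [hstd, ← Real.sqrt_mul (selfNorm_nonneg hρ _ _ _)]
    refine Real.abs_le_sqrt ((sq_dotProduct_le hG _ _).trans ?_)
    rw [mul_comm, ← selfNorm]
    exact mul_le_mul_of_nonneg_left (hwG.trans hsle) (selfNorm_nonneg hρ _ _ _)
  have hbias : |∑ q, θ q * (v / D q * w q)| ≤ √(∑ q, θ q ^ 2 / D q) * gpStd k v t x z := by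
    have hθ : 0 ≤ ∑ q, θ q ^ 2 / D q :=
      Finset.sum_nonneg fun q _ => div_nonneg (sq_nonneg _) (hD q).le
    rw [hstd, ← Real.sqrt_mul hθ]
    refine Real.abs_le_sqrt ?_
    have h1 := Finset.sum_mul_sq_le_sq_mul_sq Finset.univ (fun q => √(v / D q) * θ q)
      (fun q => √(v / D q) * w q)
    have h2 : ∀ q, √(v / D q) ^ 2 = v / D q := fun q => Real.sq_sqrt (div_pos hv0 (hD q)).le
    have h3 : ∑ q, θ q * (v / D q * w q) = ∑ q, √(v / D q) * θ q * (√(v / D q) * w q) :=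
      Finset.sum_congr rfl fun q _ => by
        rw [mul_mul_mul_comm, ← sq, h2]; ring
    rw [h3]
    refine h1.trans ?_
    simp only [mul_pow, h2]
    have h4 : ∑ q, v / D q * θ q ^ 2 = v * ∑ q, θ q ^ 2 / D q := by
      rw [Finset.mul_sum]; exact Finset.sum_congr rfl fun q _ => by ring
    rw [h4, mul_comm v, mul_assoc]
    have h5 : ∑ q, v / D q * w q ^ 2 ≤ w ⬝ᵥ Ψ z := by rw [hwz]; linarith
    gcongr
  rw [herr, add_mul]
  refine (abs_sub _ _).trans ?_
  linarith

end Posterior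

/-! ### Regret of GP-UCB along a path -/

section Regret

open Matrix

lemma tendsto_sqrt_log_natCast {d : ℝ} (hd : 0 < d) :
    Tendsto (fun t : ℕ => √(d * Real.log t)) atTop atTop :=
  Real.tendsto_sqrt_atTop.comp (tendsto_log_natCast.const_mul_atTop hd)

lemma noiseVar_succ_mem (t : ℕ) : noiseVar (t + 1) ∈ Set.Icc (1 : ℝ) 3 := by
  have h : (1 : ℝ) ≤ (t + 1 : ℕ) := by push_cast; linarith [(Nat.cast_nonneg t : (0 : ℝ) ≤ t)]
  have h0 : (0 : ℝ) < (t + 1 : ℕ) := by linarith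
  refine ⟨?_, ?_⟩
  · rw [noiseVar]; linarith [div_nonneg zero_le_two h0.le]
  · rw [noiseVar]
    have : 2 / ((t + 1 : ℕ) : ℝ) ≤ 2 := div_le_self (by norm_num) h
    linarith

/-- The exploration coefficient eventually exceeds any confidence width of the form
`a + σ √((D - 1/8) log t)`. -/
lemma eventually_le_explCoeff {σ B c₁ δ e : ℝ} (hσ : 0 < σ) (hc : 0 < c₁) (hδ : 0 < δ)
    (hδ1 : δ < 1) (hB : 0 ≤ B) (he : 0 ≤ e) {D : ℕ} (hD : 0 < D) (a : ℝ) :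
    ∀ᶠ t : ℕ in atTop, a + √(σ ^ 2 * ((D - 1 / 8) * Real.log t)) ≤
      explCoeff σ B c₁ δ e D (t + 1) := by
  have hD1 : (1 : ℝ) ≤ D := by exact_mod_cast hD
  set b : ℝ := |a| / σ with hb
  have hb0 : 0 ≤ b := by positivity
  set C : ℝ := D * Real.log (3 * c₁) with hC
  filter_upwards [eventually_ge_atTop 1, tendsto_log_natCast.eventually_ge_atTop (16 * (b ^ 2 + C)),
    (tendsto_sqrt_log_natCast (d := D) (by linarith)).eventually_ge_atTop (32 * b * D)]
    with t ht h1 h2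
  have ht1 : (1 : ℝ) ≤ t := by exact_mod_cast ht
  have hL0 : 0 ≤ Real.log t := Real.log_nonneg ht1
  set Lt := Real.log t
  set S := √(D * Lt) with hS
  have hS2 : S ^ 2 = D * Lt := Real.sq_sqrt (by positivity)
  have hS0 : 0 ≤ S := Real.sqrt_nonneg _
  obtain ⟨hv1, hv3⟩ := noiseVar_succ_mem t
  have hlog : Lt - Real.log (3 * c₁) ≤
      Real.log (1 + (noiseVar (t + 1))⁻¹ * (t + 1 : ℕ) / c₁) := by
    rw [← Real.log_div (by positivity) (by positivity)]
    refine Real.log_le_log (by positivity) ?_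
    have h3 : (3 : ℝ)⁻¹ ≤ (noiseVar (t + 1))⁻¹ := inv_anti₀ (by linarith) hv3
    have h4 : (3 : ℝ)⁻¹ * t / c₁ ≤ (noiseVar (t + 1))⁻¹ * (t + 1 : ℕ) / c₁ := by
      push_cast
      gcongr
      linarith
    have h5 : (t : ℝ) / (3 * c₁) = 3⁻¹ * t / c₁ := by field_simp
    linarith
  have hlogδ : 0 ≤ Real.log (1 / δ) := Real.log_nonneg (by rw [le_div_iff₀ hδ]; linarith)
  have hle : a / σ + √((D - 1 / 8) * Lt) ≤
      √(D * Real.log (1 + (noiseVar (t + 1))⁻¹ * (t + 1 : ℕ) / c₁) + 2 + 2 * Real.log (1 / δ)) := by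
    have h3 : D * Lt - C ≤
        D * Real.log (1 + (noiseVar (t + 1))⁻¹ * (t + 1 : ℕ) / c₁) + 2 +
          2 * Real.log (1 / δ) := by
      have := mul_le_mul_of_nonneg_left hlog (by linarith : (0 : ℝ) ≤ D)
      rw [mul_sub] at this
      linarith
    refine le_trans ?_ (Real.sqrt_le_sqrt h3)
    have h4 : a / σ ≤ b := by rw [hb]; gcongr; exact le_abs_self a
    refine Real.le_sqrt_of_sq_le ?_
    have hq0 := Real.sqrt_nonneg ((D - 1 / 8) * Lt)
    have hq2 : √((D - 1 / 8) * Lt) ^ 2 = (D - 1 / 8) * Lt :=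
      Real.sq_sqrt (mul_nonneg (by linarith) hL0)
    have hqS : √((D - 1 / 8) * Lt) ≤ S := Real.sqrt_le_sqrt (by nlinarith)
    have habs : (a / σ) ^ 2 ≤ b ^ 2 := by
      rw [hb, div_pow, div_pow, sq_abs]
    have e1 : 2 * (a / σ) * √((D - 1 / 8) * Lt) ≤ 2 * b * S := by
      have := mul_le_mul h4 hqS hq0 hb0
      linarith
    have e2 : 32 * b * S ≤ Lt := by
      have h5 : (32 * b * S) * D ≤ Lt * D := by
        calc (32 * b * S) * D = (32 * b * D) * S := by ring
          _ ≤ S * S := mul_le_mul_of_nonneg_right h2 hS0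
          _ = Lt * D := by rw [← sq, hS2, mul_comm]
      exact le_of_mul_le_mul_right h5 (by linarith)
    nlinarith
  have hsqrt : √(σ ^ 2 * ((D - 1 / 8) * Lt)) = σ * √((D - 1 / 8) * Lt) := by
    rw [Real.sqrt_mul (by positivity), Real.sqrt_sq hσ.le]
  have h6 := mul_le_mul_of_nonneg_left hle hσ.le
  rw [mul_add, mul_div_cancel₀ _ hσ.ne'] at h6
  have h7 : 0 ≤ B * (1 + e / (2 * c₁)) := by positivity
  rw [hsqrt, explCoeff]
  linarith

lemma explCoeff_le {σ B c₁ δ e : ℝ} (hσ : 0 < σ) (hc : 0 < c₁) (D : ℕ) {t T : ℕ} (h : t < T) :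
    explCoeff σ B c₁ δ e D (t + 1) ≤ B * (1 + e / (2 * c₁)) +
      σ * √(D * Real.log (1 + T / c₁) + (2 + 2 * Real.log (1 / δ))) := by
  obtain ⟨hv1, hv3⟩ := noiseVar_succ_mem t
  rw [explCoeff, add_assoc (D * _ : ℝ)]
  gcongr
  calc (noiseVar (t + 1))⁻¹ * ((t + 1 : ℕ) : ℝ) ≤ 1 * ((t + 1 : ℕ) : ℝ) := by
        gcongr; exact inv_le_one_of_one_le₀ hv1
    _ ≤ T := by rw [one_mul]; exact_mod_cast h

/-- One round of regret, with the squared width `u` replaced by `log (1 + u)`. Rounds of large width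
are charged to the trivial bound `R`. -/
lemma regret_step_le {r R u ν : ℝ} (hrR : r ≤ R) (hR : 0 ≤ R) (hu : 0 ≤ u) (hν : 0 ≤ ν)
    (h : r ≤ 2 * ν * √(3 * u)) :
    r ≤ 2 * R * Real.log (1 + u) + 2 * ν * √(6 * Real.log (1 + u)) := by
  have hlog : 1 - (1 + u)⁻¹ ≤ Real.log (1 + u) := Real.one_sub_inv_le_log_of_pos (by positivity)
  have h1 : 1 - (1 + u)⁻¹ = u / (1 + u) := by field_simp; ring
  rw [h1] at hlog
  have hl0 : 0 ≤ Real.log (1 + u) := Real.log_nonneg (by linarith)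
  rcases le_total u 1 with hu1 | hu1
  · have h2 : u / 2 ≤ u / (1 + u) := by gcongr; linarith
    have h3 : √(3 * u) ≤ √(6 * Real.log (1 + u)) := Real.sqrt_le_sqrt (by linarith)
    have h4 := mul_le_mul_of_nonneg_left h3 (by positivity : 0 ≤ 2 * ν)
    have h5 : 0 ≤ 2 * R * Real.log (1 + u) := by positivity
    linarith
  · have h2 : 1 / 2 ≤ u / (1 + u) := by rw [div_le_div_iff₀ (by norm_num) (by positivity)]; linarith
    have h3 : R * (1 / 2) ≤ R * Real.log (1 + u) := by gcongr; linarith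
    have h5 : 0 ≤ 2 * ν * √(6 * Real.log (1 + u)) := by positivity
    linarith

lemma tendsto_log_div_sqrt : Tendsto (fun T : ℕ => Real.log T / √(T : ℝ)) atTop (𝓝 0) := by
  have h := (isLittleO_log_rpow_atTop (r := 1 / 2) (by norm_num)).tendsto_div_nhds_zero
  simp_rw [← Real.sqrt_eq_rpow] at h
  exact h.comp tendsto_natCast_atTop_atTop

lemma sqrt_mul_sqrt_eq {d T L : ℝ} (hT : 0 ≤ T) (hdL : 0 ≤ d * L) :
    √(d * T * L) * √(d * L) = √T * (d * L) := by
  rw [show d * T * L = T * (d * L) by ring, Real.sqrt_mul hT, mul_assoc, Real.mul_self_sqrt hdL]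

/-- Summing the rounds: once the confidence bounds are valid, the regret is of order
`√(d T log T) √(d log T)`, with a constant that depends on the noise level only. -/
lemma eventually_sum_le {r u ν : ℕ → ℝ} {R κ d A H c₁ σ : ℝ} (hr : ∀ t, r t ≤ R) (hR : 0 ≤ R)
    (hu : ∀ t, 0 ≤ u t) (hκ : 0 ≤ κ) (hd : 1 ≤ d) (hA : 0 ≤ A) (hH : 0 ≤ H) (hc : 0 < c₁)
    (hσ : 0 < σ) (hsum : ∀ T : ℕ, ∑ t ∈ Finset.range T, Real.log (1 + u t) ≤
      d * Real.log (1 + κ * T))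
    (hν : ∀ t T : ℕ, t < T → ν t ≤ A + σ * √(d * Real.log (1 + T / c₁) + H))
    (hstep : ∀ᶠ t in atTop, r t ≤ 2 * ν t * √(3 * u t)) :
    ∀ᶠ T : ℕ in atTop, ∑ t ∈ Finset.range T, r t ≤
      (14 * σ + 1) * (√(d * T * Real.log T) * √(d * Real.log T)) := by
  obtain ⟨t₀, ht₀⟩ := eventually_atTop.1 hstep
  have hsmall := tendsto_sqrt_log_natCast (d := 1) one_pos
  filter_upwards [eventually_ge_atTop 1, tendsto_log_natCast.eventually_ge_atTop 1,
    tendsto_log_natCast.eventually_ge_atTop (Real.log (1 + κ)),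
    tendsto_log_natCast.eventually_ge_atTop (Real.log (1 + 1 / c₁) + H),
    hsmall.eventually_ge_atTop (2 * A / σ),
    (Real.tendsto_sqrt_atTop.comp tendsto_natCast_atTop_atTop).eventually_ge_atTop
      (t₀ * R + 4 * R)] with T hT hL1 hLκ hLc hSA hTR
  have hT1 : (1 : ℝ) ≤ T := by exact_mod_cast hT
  simp only [Function.comp_apply] at hTR
  rw [one_mul] at hSA
  set L := Real.log T with hL
  set N : ℝ := A + σ * √(d * Real.log (1 + T / c₁) + H) with hN
  set ℓ : ℕ → ℝ := fun t => Real.log (1 + u t) with hℓ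
  have hℓ0 : ∀ t, 0 ≤ ℓ t := fun t => Real.log_nonneg (by linarith [hu t])
  have hN0 : 0 ≤ N := by positivity
  have hround : ∀ t ∈ Finset.range T, r t ≤
      (if t < t₀ then R else 0) + 2 * R * ℓ t + 2 * N * √(6 * ℓ t) := by
    intro t ht
    have h0 : 0 ≤ 2 * R * ℓ t := mul_nonneg (by positivity) (hℓ0 t)
    have h1 : 0 ≤ 2 * N * √(6 * ℓ t) := by positivity
    split_ifs with htt
    · linarith [hr t]
    · have h2 := ht₀ t (not_lt.1 htt)
      have h3 : 2 * ν t * √(3 * u t) ≤ 2 * N * √(3 * u t) := by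
        have := hν t T (Finset.mem_range.1 ht)
        gcongr
      linarith [regret_step_le (hr t) hR (hu t) hN0 (h2.trans h3)]
  have hlogT : ∑ t ∈ Finset.range T, ℓ t ≤ 2 * (d * L) := by
    refine (hsum T).trans ?_
    have h1 : Real.log (1 + κ * T) ≤ Real.log (1 + κ) + L := by
      rw [hL, ← Real.log_mul (by positivity) (by positivity)]
      refine Real.log_le_log (by positivity) ?_
      linarith
    have h2 : Real.log (1 + κ * T) ≤ 2 * L := by linarith
    have := mul_le_mul_of_nonneg_left h2 (by linarith : 0 ≤ d)
    linarith
  have hdL : 0 ≤ d * L := by positivity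
  have hfirst : ∑ t ∈ Finset.range T, (if t < t₀ then R else 0) ≤ t₀ * R := by
    rw [← Finset.sum_filter, Finset.sum_const, nsmul_eq_mul]
    gcongr
    calc _ ≤ (Finset.range t₀).card := Finset.card_le_card fun t ht => by
          simpa using (Finset.mem_filter.1 ht).2
      _ = t₀ := Finset.card_range t₀
  have hcs : ∑ t ∈ Finset.range T, √(6 * ℓ t) ≤ √(T * (12 * (d * L))) := by
    refine Real.le_sqrt_of_sq_le ((sq_sum_le_card_mul_sum_sq).trans ?_)
    rw [Finset.card_range]
    gcongr
    calc ∑ t ∈ Finset.range T, √(6 * ℓ t) ^ 2 = 6 * ∑ t ∈ Finset.range T, ℓ t := by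
          rw [Finset.mul_sum]
          exact Finset.sum_congr rfl fun t _ => Real.sq_sqrt (by linarith [hℓ0 t])
      _ ≤ _ := by linarith
  set S := √(d * L) with hS
  have hS0 : 0 ≤ S := Real.sqrt_nonneg _
  have hSS : S * S = d * L := Real.mul_self_sqrt hdL
  have hNle : N ≤ 2 * σ * S := by
    have h1 : Real.log (1 + T / c₁) ≤ Real.log (1 + 1 / c₁) + L := by
      rw [hL, ← Real.log_mul (by positivity) (by positivity)]
      refine Real.log_le_log (by positivity) ?_
      have : (1 + 1 / c₁) * T = T + T / c₁ := by ring
      linarith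
    have h2 : d * Real.log (1 + T / c₁) + H ≤ 3 / 2 * (3 / 2) * (d * L) := by
      have e1 := mul_le_mul_of_nonneg_left h1 (by linarith : 0 ≤ d)
      have e2 : H ≤ d * H := le_mul_of_one_le_left hH hd
      have e3 := mul_le_mul_of_nonneg_left hLc (by linarith : 0 ≤ d)
      linarith
    have h3 : √(d * Real.log (1 + T / c₁) + H) ≤ 3 / 2 * S := by
      refine (Real.sqrt_le_sqrt h2).trans ?_
      rw [Real.sqrt_mul (by norm_num), Real.sqrt_mul_self (by norm_num)]
    have h4 : √L ≤ S := Real.sqrt_le_sqrt (le_mul_of_one_le_left (by linarith) hd)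
    have h5 : A ≤ σ * S / 2 := by
      have := hSA.trans h4
      rw [div_le_iff₀ hσ] at this
      linarith
    have h6 := mul_le_mul_of_nonneg_left h3 hσ.le
    linarith
  have hQ : √(T * (12 * (d * L))) ≤ 7 / 2 * √(d * T * L) := by
    have h1 : (T : ℝ) * (12 * (d * L)) ≤ 7 / 2 * (7 / 2) * (d * T * L) := by
      have : 0 ≤ d * T * L := by positivity
      linarith
    refine (Real.sqrt_le_sqrt h1).trans ?_
    rw [Real.sqrt_mul (by norm_num), Real.sqrt_mul_self (by norm_num)]
  have hsplit : √(d * T * L) * S = √(T : ℝ) * (d * L) := by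
    exact sqrt_mul_sqrt_eq (by positivity) hdL
  have hlow : t₀ * R + 4 * R * (d * L) ≤ √(d * T * L) * S := by
    rw [hsplit]
    have h1 : 1 ≤ d * L := by nlinarith
    calc t₀ * R + 4 * R * (d * L) ≤ t₀ * R * (d * L) + 4 * R * (d * L) := by
          have := le_mul_of_one_le_right (by positivity : 0 ≤ t₀ * R) h1
          linarith
      _ = (t₀ * R + 4 * R) * (d * L) := by ring
      _ ≤ _ := by gcongr
  calc ∑ t ∈ Finset.range T, r t
      ≤ ∑ t ∈ Finset.range T, ((if t < t₀ then R else 0) + 2 * R * ℓ t + 2 * N * √(6 * ℓ t)) :=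
        Finset.sum_le_sum hround
    _ = ∑ t ∈ Finset.range T, (if t < t₀ then R else 0) + 2 * R * ∑ t ∈ Finset.range T, ℓ t +
        2 * N * ∑ t ∈ Finset.range T, √(6 * ℓ t) := by
        rw [Finset.sum_add_distrib, Finset.sum_add_distrib, Finset.mul_sum, Finset.mul_sum]
    _ ≤ t₀ * R + 2 * R * (2 * (d * L)) +
        2 * (2 * σ * S) * (7 / 2 * √(d * T * L)) := by
        gcongr
        exact hcs.trans hQ
    _ = (t₀ * R + 4 * R * (d * L)) + 14 * σ * (√(d * T * L) * S) := by ring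
    _ ≤ _ := by linarith

/-- Regret of GP-UCB with a kernel whose feature weights are positive, along a path on which the
self-normalized noise grows slightly slower than `σ² D log t`, where `D` is the dimension. -/
theorem eventually_regret_le {X ι : Type*} [Fintype ι] [DecidableEq ι] [Nonempty ι]
    {Ψ : X → ι → ℝ} {W : ι → ℝ} (hW : ∀ q, 0 < W q) {k : X → X → ℝ}
    (hk : ∀ x x', k x x' = ∑ q, W q * (Ψ x q * Ψ x' q)) {ρ κ : ℝ} (hρ : 0 < ρ)
    (hρW : ∀ q, ρ * W q ≤ 1) (hκ : ∀ x, Ψ x ⬝ᵥ Ψ x ≤ κ) {f : X → ℝ} {θ : ι → ℝ}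
    (hf : ∀ x, f x = θ ⬝ᵥ Ψ x) {xstar : X} (hmax : ∀ x, f x ≤ f xstar)
    {σ B c₁ δ e : ℝ} (hσ : 0 < σ) (hc : 0 < c₁) (hδ : 0 < δ)
    (hδ1 : δ < 1) (hB : 0 ≤ B) (he : 0 ≤ e) {x : ℕ → X} {ε : ℕ → ℝ}
    (hucb : IsGPUCB k (explCoeff σ B c₁ δ e (Fintype.card ι)) x (fun t => f (x t) + ε t))
    (hnoise : ∀ᶠ t : ℕ in atTop, selfNorm ρ (fun s => Ψ (x s)) ε t ≤
      σ ^ 2 * ((Fintype.card ι - 1 / 8) * Real.log t)) :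
    (∀ᶠ T : ℕ in atTop, regret f xstar x T ≤
      (14 * σ + 1) * regretRate B δ e (Fintype.card ι) T) ∧
    Tendsto (fun T : ℕ => regret f xstar x T / T) atTop (𝓝 0) := by
  set D := Fintype.card ι with hDdef
  have hD : 0 < D := Fintype.card_pos
  have hD1 : (1 : ℝ) ≤ D := by exact_mod_cast hD
  have hlogδ : 0 ≤ Real.log (1 / δ) := Real.log_nonneg (by rw [le_div_iff₀ hδ]; linarith)
  have hnn : ∀ a : ι → ℝ, 0 ≤ a ⬝ᵥ a := fun a => by simpa using dotProduct_star_self_nonneg a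
  have hκ0 : 0 ≤ κ := (hnn _).trans (hκ xstar)
  have hfb : ∀ z, |f z| ≤ √((θ ⬝ᵥ θ) * κ) := by
    intro z
    rw [hf]
    exact Real.abs_le_sqrt ((sq_dotProduct_le_mul _ _).trans
      (mul_le_mul_of_nonneg_left (hκ z) (hnn θ)))
  set ψ : ℕ → ι → ℝ := fun s => Ψ (x s) with hψ
  set u : ℕ → ℝ := fun t => ψ t ⬝ᵥ (regGram ρ ψ t)⁻¹ *ᵥ ψ t with hu
  have hu0 : ∀ t, 0 ≤ u t := fun t => quadForm_nonneg (regGram_posDef hρ ψ t).inv _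
  have hsum : ∀ T : ℕ, ∑ t ∈ Finset.range T, Real.log (1 + u t) ≤
      D * Real.log (1 + κ / ρ * T) := by
    intro T
    have h1 : Real.log (regGram ρ ψ T).det =
        D * Real.log ρ + ∑ t ∈ Finset.range T, Real.log (1 + u t) := by
      induction T with
      | zero => simp [log_det_regGram_zero, hDdef]
      | succ T ih => rw [log_det_regGram_succ hρ, ih, Finset.sum_range_succ, add_assoc]
    have h2 := log_det_regGram_le hρ hκ0 (fun s => hκ (x s)) T
    have h3 : ρ + κ * T = ρ * (1 + κ / ρ * T) := by field_simp
    rw [h1, h3, Real.log_mul hρ.ne' (by positivity), mul_add] at h2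
    linarith
  set ν : ℕ → ℝ := fun t => explCoeff σ B c₁ δ e D (t + 1) with hνdef
  have hstep : ∀ᶠ t in atTop, f xstar - f (x t) ≤ 2 * ν t * √(3 * u t) := by
    filter_upwards [hnoise, eventually_le_explCoeff hσ hc hδ hδ1 hB he hD
      (√(∑ q, θ q ^ 2 / W q))] with t ht1 ht2
    obtain ⟨hv1, hv3⟩ := noiseVar_succ_mem t
    have hwidth : √(∑ q, θ q ^ 2 / W q) + √(selfNorm ρ ψ ε t) ≤ ν t :=
      le_trans (by gcongr) ht2
    have hconf : ∀ z, |gpMean k (noiseVar (t + 1)) t x (fun t => f (x t) + ε t) z - f z| ≤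
        ν t * gpStd k (noiseVar (t + 1)) t x z := by
      intro z
      simp_rw [hf]
      refine (posterior_bounds hW hk hv1 hρ hρW t x θ ε z).2.trans ?_
      exact mul_le_mul_of_nonneg_right hwidth (Real.sqrt_nonneg _)
    have hν0 : 0 ≤ ν t := le_trans (by positivity) hwidth
    have hstd : gpStd k (noiseVar (t + 1)) t x (x t) ≤ √(3 * u t) := by
      refine (posterior_bounds hW hk hv1 hρ hρW t x θ ε (x t)).1.trans (Real.sqrt_le_sqrt ?_)
      exact mul_le_mul_of_nonneg_right hv3 (hu0 t)
    have h1 := (abs_le.1 (hconf xstar)).1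
    have h2 := (abs_le.1 (hconf (x t))).2
    have h3 := hucb t xstar
    have h4 := mul_le_mul_of_nonneg_left hstd hν0
    have h5 : explCoeff σ B c₁ δ e D (t + 1) = ν t := rfl
    rw [h5] at h3
    linarith
  have hmain := eventually_sum_le (r := fun t => f xstar - f (x t)) (u := u) (ν := ν)
    (R := 2 * √((θ ⬝ᵥ θ) * κ)) (fun t => by
      have h1 := (abs_le.1 (hfb xstar)).2
      have h2 := (abs_le.1 (hfb (x t))).1
      linarith) (by positivity) hu0 (by positivity : 0 ≤ κ / ρ) hD1
    (by positivity : 0 ≤ B * (1 + e / (2 * c₁)))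
    (by positivity : 0 ≤ 2 + 2 * Real.log (1 / δ)) hc hσ hsum
    (fun t T h => explCoeff_le hσ hc D h) hstep
  refine ⟨?_, ?_⟩
  · filter_upwards [hmain, eventually_ge_atTop 1] with T hT hT1
    refine hT.trans (mul_le_mul_of_nonneg_left ?_ (by positivity))
    rw [regretRate]
    have h1 : √(D * Real.log T) ≤ √(D * Real.log T + Real.log (1 / δ)) :=
      Real.sqrt_le_sqrt (by linarith)
    have h2 : 0 ≤ B * (1 + e) := by positivity
    exact mul_le_mul_of_nonneg_left (by linarith) (Real.sqrt_nonneg _)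
  · have hlim : Tendsto (fun T : ℕ => (14 * σ + 1) * D * (Real.log T / √(T : ℝ))) atTop (𝓝 0) := by
      simpa using tendsto_log_div_sqrt.const_mul ((14 * σ + 1) * D)
    refine squeeze_zero' (.of_forall fun T => ?_) ?_ hlim
    · exact div_nonneg (Finset.sum_nonneg fun t _ => sub_nonneg.2 (hmax _)) (Nat.cast_nonneg T)
    · filter_upwards [hmain, eventually_ge_atTop 1] with T hT hT1
      have hT0 : (0 : ℝ) < T := by exact_mod_cast hT1
      have hL0 : 0 ≤ Real.log T := Real.log_nonneg (by exact_mod_cast hT1)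
      have hs : √(T : ℝ) * √(T : ℝ) = T := Real.mul_self_sqrt hT0.le
      have hs0 : 0 < √(T : ℝ) := Real.sqrt_pos.2 hT0
      have h1 : √(D * T * Real.log T) * √(D * Real.log T) = √(T : ℝ) * (D * Real.log T) :=
        sqrt_mul_sqrt_eq hT0.le (by positivity)
      rw [div_le_iff₀ hT0]
      calc regret f xstar x T ≤ (14 * σ + 1) * (√(T : ℝ) * (D * Real.log T)) := by
            rw [← h1]; exact hT
        _ = (14 * σ + 1) * D * (Real.log T / √(T : ℝ)) * (√(T : ℝ) * √(T : ℝ)) := by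
            field_simp
        _ = _ := by rw [hs]

end Regret

/-! ### Reproducing kernel Hilbert spaces of finite-dimensional feature maps -/

section FeatureRKHS

variable {X F : Type*} [NormedAddCommGroup F] [InnerProductSpace ℝ F]

/-- The function `h` of a reproducing kernel Hilbert space is represented by the vector `c` of the
feature space: it is given by `c`, and inner products with `h` can be computed in the feature
space. -/
def Represents {H : Type*} [NormedAddCommGroup H] [InnerProductSpace ℝ H] [RKHS ℝ H X ℝ]
    (Φ : X → F) (h : H) (c : F) : Prop :=
  (∀ x, h x = inner ℝ (Φ x) c) ∧
    ∀ (g : H) (b : F), (∀ x, g x = inner ℝ (Φ x) b) → inner ℝ h g = inner ℝ c b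

namespace Represents

variable {H : Type*} [NormedAddCommGroup H] [InnerProductSpace ℝ H] [RKHS ℝ H X ℝ]
  {Φ : X → F} {h h' : H} {c c' : F}

lemma zero : Represents Φ (0 : H) (0 : F) :=
  ⟨fun x => by simp, fun g b _ => by simp⟩

lemma add (hc : Represents Φ h c) (hc' : Represents Φ h' c') :
    Represents Φ (h + h') (c + c') :=
  ⟨fun x => by simp [hc.1, hc'.1, inner_add_right], fun g b hb => by
    rw [inner_add_left, inner_add_left, hc.2 g b hb, hc'.2 g b hb]⟩

lemma smul (hc : Represents Φ h c) (a : ℝ) : Represents Φ (a • h) (a • c) :=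
  ⟨fun x => by simp [hc.1, inner_smul_right], fun g b hb => by
    rw [real_inner_smul_left, real_inner_smul_left, hc.2 g b hb]⟩

lemma norm_eq (hc : Represents Φ h c) : ‖h‖ = ‖c‖ := by
  have := hc.2 h c hc.1
  rw [real_inner_self_eq_norm_sq, real_inner_self_eq_norm_sq] at this
  exact (pow_left_inj₀ (norm_nonneg _) (norm_nonneg _) two_ne_zero).1 this

lemma kerFun [CompleteSpace H] {k : X → X → ℝ} (hk : ∀ x x', k x x' = inner ℝ (Φ x) (Φ x'))
    (hK : RKHS.kernel H = opKernel k) (x : X) (v : ℝ) :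
    Represents Φ (RKHS.kerFun H x v) (v • Φ x) := by
  refine ⟨fun y => ?_, fun g b hb => ?_⟩
  · rw [RKHS.kerFun_apply, hK, opKernel, Matrix.of_apply, hk, inner_smul_right]
    simp [mul_comm]
  · rw [RKHS.kerFun_inner, hb, real_inner_smul_left]
    simp [mul_comm]

end Represents

lemma opKernel_posSemidef {Φ : X → F} {k : X → X → ℝ}
    (hk : ∀ x x', k x x' = inner ℝ (Φ x) (Φ x')) : (opKernel k).PosSemidef := by
  have hiff := (RKHS.posSemidef_tfae (K := opKernel k)).out 0 2
  refine hiff.2 ⟨?_, fun vv => ?_⟩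
  · ext x x'
    have hid : star (ContinuousLinearMap.id ℝ ℝ) = ContinuousLinearMap.id ℝ ℝ := star_one _
    simp [opKernel, hk, Matrix.conjTranspose_apply, real_inner_comm, hid]
  · have h : (vv.sum fun x w => vv.sum fun x' w' => inner ℝ (opKernel k x' x w) w') =
        inner ℝ (vv.sum fun x w => w • Φ x) (vv.sum fun x w => w • Φ x) := by
      simp only [Finsupp.sum, sum_inner, inner_sum]
      refine Finset.sum_congr rfl fun x _ => Finset.sum_congr rfl fun x' _ => ?_
      simp [opKernel, hk, inner_smul_left, inner_smul_right, real_inner_comm]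
      ring
    rw [h]
    simp

variable [FiniteDimensional ℝ F]

/-- A function in the space of a kernel with feature map `Φ` is linear in the features, with a
coefficient vector that is not longer than the function. -/
lemma HasRKHSNorm.exists_coeff {Φ : X → F} {k : X → X → ℝ}
    (hk : ∀ x x', k x x' = inner ℝ (Φ x) (Φ x')) {f : X → ℝ} {r : ℝ} (hf : HasRKHSNorm k f r) :
    0 ≤ r ∧ ∃ c : F, (∀ x, f x = inner ℝ (Φ x) c) ∧ ‖c‖ ≤ r := by
  obtain ⟨hps, g, hg, hr⟩ := hf
  have : Fact (opKernel k).PosSemidef := ⟨hps⟩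
  refine ⟨hr ▸ norm_nonneg g, ?_⟩
  have hK : RKHS.kernel (RKHS.OfKernel (opKernel k)) = opKernel k := RKHS.OfKernel.kernel_ofKernel
  have hspan : ∀ h ∈ Submodule.span ℝ {RKHS.kerFun (RKHS.OfKernel (opKernel k)) x v | (x) (v)},
      ∃ c : F, Represents Φ h c := by
    intro h hh
    induction hh using Submodule.span_induction with
    | mem h hh =>
      obtain ⟨x, v, rfl⟩ := hh
      exact ⟨_, Represents.kerFun hk hK x v⟩
    | zero => exact ⟨0, Represents.zero⟩
    | add a b _ _ ha hb =>
      obtain ⟨c, hc⟩ := ha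
      obtain ⟨c', hc'⟩ := hb
      exact ⟨_, hc.add hc'⟩
    | smul a b _ hb =>
      obtain ⟨c, hc⟩ := hb
      exact ⟨_, hc.smul a⟩
  have hmem : g ∈ closure (Submodule.span ℝ
      {RKHS.kerFun (RKHS.OfKernel (opKernel k)) x v | (x) (v)} : Set _) := by
    have := RKHS.kerFun_dense (RKHS.OfKernel (opKernel k))
    rw [← Submodule.topologicalClosure_coe, this]
    trivial
  obtain ⟨hn, hmem_n, hlim⟩ := mem_closure_iff_seq_limit.1 hmem
  choose c hc using fun n => hspan (hn n) (hmem_n n)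
  have hnorm : Tendsto (fun n => ‖c n‖) atTop (𝓝 ‖g‖) := by
    simpa only [(hc _).norm_eq] using hlim.norm
  obtain ⟨M, hM⟩ := hnorm.bddAbove_range
  have hball : ∀ n, c n ∈ Metric.closedBall (0 : F) M := fun n => by
    simpa using hM ⟨n, rfl⟩
  obtain ⟨c₀, -, s, hs, hcs⟩ := (isCompact_closedBall (0 : F) M).tendsto_subseq hball
  refine ⟨c₀, fun x => ?_, ?_⟩
  · rw [← hg]
    have h1 : Tendsto (fun n => hn (s n) x) atTop (𝓝 (g x)) :=
      ((RKHS.continuous_eval x).tendsto g).comp (hlim.comp hs.tendsto_atTop)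
    have h2 : Tendsto (fun n => inner ℝ (Φ x) (c (s n))) atTop (𝓝 (inner ℝ (Φ x) c₀)) :=
      (Continuous.tendsto (by fun_prop : Continuous fun c : F => inner ℝ (Φ x) c) c₀).comp hcs
    refine tendsto_nhds_unique h1 (h2.congr fun n => ?_)
    exact ((hc (s n)).1 x).symm
  · rw [← hr]
    exact (tendsto_nhds_unique hcs.norm (hnorm.comp hs.tendsto_atTop)).le

/-- A function that is linear in the features belongs to the space of the kernel, and is not longer
than its coefficient vector. -/
lemma exists_hasRKHSNorm {Φ : X → F} {k : X → X → ℝ}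
    (hk : ∀ x x', k x x' = inner ℝ (Φ x) (Φ x')) (c : F) :
    ∃ r, 0 ≤ r ∧ r ≤ ‖c‖ ∧ HasRKHSNorm k (fun x => inner ℝ (Φ x) c) r := by
  have hps := opKernel_posSemidef hk
  have : Fact (opKernel k).PosSemidef := ⟨hps⟩
  have hK : RKHS.kernel (RKHS.OfKernel (opKernel k)) = opKernel k := RKHS.OfKernel.kernel_ofKernel
  set S := Submodule.span ℝ (Set.range Φ) with hS
  have hspan : ∀ b ∈ S, ∃ h : RKHS.OfKernel (opKernel k), Represents Φ h b := by
    intro b hb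
    induction hb using Submodule.span_induction with
    | mem h hh =>
      obtain ⟨x, rfl⟩ := hh
      exact ⟨_, by simpa using Represents.kerFun hk hK x 1⟩
    | zero => exact ⟨0, Represents.zero⟩
    | add a b _ _ ha hb =>
      obtain ⟨c, hc⟩ := ha
      obtain ⟨c', hc'⟩ := hb
      exact ⟨_, hc.add hc'⟩
    | smul a b _ hb =>
      obtain ⟨c, hc⟩ := hb
      exact ⟨_, hc.smul a⟩
  obtain ⟨h, hh⟩ := hspan (S.starProjection c) (S.starProjection_apply_mem c)
  refine ⟨‖h‖, norm_nonneg _, ?_, hps, h, fun x => ?_, rfl⟩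
  · rw [hh.norm_eq]
    exact S.norm_starProjection_apply_le c
  · rw [hh.1 x]
    have hx : Φ x ∈ S := Submodule.subset_span ⟨x, rfl⟩
    have := S.starProjection_inner_eq_zero c (Φ x) hx
    rw [inner_sub_left, real_inner_comm, real_inner_comm (Φ x)] at this
    linarith

end FeatureRKHS

section MixRKHS

variable {X : Type*} {p : ℕ} {d : Fin p → ℕ} {φ : (j : Fin p) → X → EuclideanSpace ℝ (Fin (d j))}
  {η : Fin p → ℝ}

/-- The joint feature map `x ↦ (√η_j φ_j(x))_j` of the mixture kernel. -/
noncomputable def mixFeature (φ : (j : Fin p) → X → EuclideanSpace ℝ (Fin (d j)))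
    (η : Fin p → ℝ) (x : X) :
    PiLp 2 fun j => EuclideanSpace ℝ (Fin (d j)) :=
  WithLp.toLp 2 fun j => √(η j) • φ j x

lemma inner_mixFeature (x : X) (c : PiLp 2 fun j => EuclideanSpace ℝ (Fin (d j))) :
    inner ℝ (mixFeature φ η x) c = ∑ j, √(η j) * inner ℝ (φ j x) (c j) := by
  simp [mixFeature, PiLp.inner_apply, inner_smul_left]

lemma mixKernel_eq_inner (hη : ∀ j, 0 ≤ η j) (x x' : X) :
    mixKernel φ η x x' = inner ℝ (mixFeature φ η x) (mixFeature φ η x') := by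
  rw [inner_mixFeature, mixKernel]
  refine Finset.sum_congr rfl fun j _ => ?_
  simp only [mixFeature, inner_smul_right]
  rw [← mul_assoc, Real.mul_self_sqrt (hη j)]

lemma exists_coeff_of_hasRKHSNorm (hη : ∀ j, 0 ≤ η j) {f : X → ℝ} {r : ℝ}
    (hf : HasRKHSNorm (mixKernel φ η) f r) :
    0 ≤ r ∧ ∃ c : (j : Fin p) → EuclideanSpace ℝ (Fin (d j)),
      (∀ x, f x = ∑ j, √(η j) * inner ℝ (φ j x) (c j)) ∧ ∑ j, ‖c j‖ ^ 2 ≤ r ^ 2 := by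
  obtain ⟨hr, c, hc, hn⟩ := hf.exists_coeff (mixKernel_eq_inner hη)
  refine ⟨hr, c.ofLp, fun x => by rw [hc, inner_mixFeature], ?_⟩
  rw [← PiLp.norm_sq_eq_of_L2]
  gcongr

lemma exists_hasRKHSNorm_of_coeff (hη : ∀ j, 0 ≤ η j)
    (c : (j : Fin p) → EuclideanSpace ℝ (Fin (d j))) :
    ∃ r, r ^ 2 ≤ ∑ j, ‖c j‖ ^ 2 ∧
      HasRKHSNorm (mixKernel φ η) (fun x => ∑ j, √(η j) * inner ℝ (φ j x) (c j)) r := by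
  obtain ⟨r, hr0, hr, h⟩ := exists_hasRKHSNorm (mixKernel_eq_inner (φ := φ) hη) (WithLp.toLp 2 c)
  refine ⟨r, ?_, ?_⟩
  · calc r ^ 2 ≤ ‖WithLp.toLp 2 c‖ ^ 2 := by gcongr
      _ = _ := PiLp.norm_sq_eq_of_L2 _ _
  · simpa only [inner_mixFeature] using h

end MixRKHS

/-! ### Support recovery by Meta-KeL -/

section SupportRecovery

variable {X : Type*} {m n p : ℕ} {d : Fin p → ℕ}
  {φ : (j : Fin p) → X → EuclideanSpace ℝ (Fin (d j))}

/-- The blocks of `b` that belong to base kernel `j`, stacked into one Euclidean vector. -/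
def stackBlock (b : Coeff m d) (j : Fin p) : PiLp 2 fun _ : Fin m => EuclideanSpace ℝ (Fin (d j)) :=
  WithLp.toLp 2 fun s => b s j

lemma groupNorm_eq_norm (b : Coeff m d) (j : Fin p) : groupNorm b j = ‖stackBlock b j‖ := by
  rw [groupNorm, PiLp.norm_eq_of_L2]
  rfl

lemma groupNorm_nonneg (b : Coeff m d) (j : Fin p) : 0 ≤ groupNorm b j := Real.sqrt_nonneg _

lemma groupNorm_sq (b : Coeff m d) (j : Fin p) : groupNorm b j ^ 2 = ∑ s, ‖b s j‖ ^ 2 :=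
  Real.sq_sqrt (Finset.sum_nonneg fun _ _ => sq_nonneg _)

/-- The value at `z` of the function with coefficient blocks `b`. -/
noncomputable def predict (φ : (j : Fin p) → X → EuclideanSpace ℝ (Fin (d j)))
    (b : (j : Fin p) → EuclideanSpace ℝ (Fin (d j))) (z : X) : ℝ :=
  ∑ j, inner ℝ (φ j z) (b j)

/-- The mean squared error of the coefficients `b` on the meta-data. -/
noncomputable def meanSqLoss (φ : (j : Fin p) → X → EuclideanSpace ℝ (Fin (d j)))
    (x : Fin m → Fin n → X) (y : Fin m → Fin n → ℝ) (b : Coeff m d) : ℝ :=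
  (1 / (m : ℝ)) * ∑ s, (1 / (n : ℝ)) * ∑ i, (y s i - predict φ (b s) (x s i)) ^ 2

variable {lam : ℝ} {x : Fin m → Fin n → X} {y : Fin m → Fin n → ℝ}

/-- A feasible point of Meta-KeL costs at least as much as its coefficients do in the group lasso,
by the inequality of arithmetic and geometric means. -/
lemma exists_groupLasso_le_metaObjective (hlam : 0 ≤ lam) {η : Fin p → ℝ} {g : Fin m → X → ℝ}
    {r : Fin m → ℝ} (h : MetaFeasible φ η g r) :
    ∃ b : Coeff m d, (∀ j, η j = 0 → ∀ s, b s j = 0) ∧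
      meanSqLoss φ x y b + lam * ∑ j, groupNorm b j ≤ metaObjective lam x y η g r := by
  obtain ⟨hη, hg⟩ := h
  choose hr c hc hcr using fun s => exists_coeff_of_hasRKHSNorm hη (hg s)
  refine ⟨fun s j => √(η j) • c s j, fun j hj s => by simp [hj], ?_⟩
  have hpred : ∀ s z, predict φ (fun j => √(η j) • c s j) z = g s z := fun s z => by
    simp only [predict, hc, inner_smul_right]
  have hpen : ∀ j, 2 * groupNorm (fun s j => √(η j) • c s j) j ≤ ∑ s, ‖c s j‖ ^ 2 + η j := by
    intro j
    have h1 : groupNorm (fun s j => √(η j) • c s j) j = √(η j) * √(∑ s, ‖c s j‖ ^ 2) := by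
      rw [groupNorm, ← Real.sqrt_mul (hη j), Finset.mul_sum]
      congr 1
      refine Finset.sum_congr rfl fun s _ => ?_
      rw [norm_smul, mul_pow, Real.norm_eq_abs, sq_abs, Real.sq_sqrt (hη j)]
    have h2 := two_mul_le_add_sq (√(η j)) (√(∑ s, ‖c s j‖ ^ 2))
    rw [Real.sq_sqrt (hη j), Real.sq_sqrt (Finset.sum_nonneg fun _ _ => sq_nonneg _)] at h2
    rw [h1]
    linarith
  have hsum : 2 * ∑ j, groupNorm (fun s j => √(η j) • c s j) j ≤ ∑ s, r s ^ 2 + ∑ j, |η j| := by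
    rw [Finset.mul_sum]
    refine (Finset.sum_le_sum fun j _ => hpen j).trans ?_
    rw [Finset.sum_add_distrib, Finset.sum_comm]
    gcongr with s _ j _
    · exact hcr s
    · exact le_abs_self _
  simp only [metaObjective, meanSqLoss, hpred]
  have := mul_le_mul_of_nonneg_left hsum (by positivity : 0 ≤ lam / 2)
  linarith

/-- The group lasso cost of any coefficients is attained by a feasible point of Meta-KeL: the weight
of each base kernel is the group norm of its block. -/
lemma exists_metaObjective_le_groupLasso (hlam : 0 ≤ lam) (b : Coeff m d) :
    ∃ (η : Fin p → ℝ) (g : Fin m → X → ℝ) (r : Fin m → ℝ), MetaFeasible φ η g r ∧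
      metaObjective lam x y η g r ≤ meanSqLoss φ x y b + lam * ∑ j, groupNorm b j := by
  set η : Fin p → ℝ := fun j => groupNorm b j with hηdef
  have hη : ∀ j, 0 ≤ η j := groupNorm_nonneg b
  set c : Coeff m d := fun s j => (√(η j))⁻¹ • b s j with hc
  have hb : ∀ s j, √(η j) • c s j = b s j := by
    intro s j
    by_cases h0 : η j = 0
    · have h1 : ∑ s, ‖b s j‖ ^ 2 = 0 := by
        simp only [hηdef] at h0
        rw [← groupNorm_sq, h0, zero_pow two_ne_zero]
      have h2 := (Finset.sum_eq_zero_iff_of_nonneg fun s _ => sq_nonneg ‖b s j‖).1 h1 s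
        (Finset.mem_univ s)
      have h3 : b s j = 0 := by simpa using h2
      simp [h0, h3]
    · have : √(η j) ≠ 0 := (Real.sqrt_pos.2 ((hη j).lt_of_ne' h0)).ne'
      rw [hc, smul_smul, mul_inv_cancel₀ this, one_smul]
  choose r hr hnorm using fun s => exists_hasRKHSNorm_of_coeff (φ := φ) hη (c s)
  refine ⟨η, _, r, ⟨hη, hnorm⟩, ?_⟩
  have hpred : ∀ s z, ∑ j, √(η j) * inner ℝ (φ j z) (c s j) = predict φ (b s) z := by
    intro s z
    refine Finset.sum_congr rfl fun j _ => ?_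
    rw [← inner_smul_right, hb]
  have hpen : ∀ j, ∑ s, ‖c s j‖ ^ 2 = η j := by
    intro j
    have h1 : ∑ s, ‖c s j‖ ^ 2 = (η j)⁻¹ * (η j) ^ 2 := by
      rw [hηdef, groupNorm_sq, Finset.mul_sum]
      refine Finset.sum_congr rfl fun s _ => ?_
      rw [hc, norm_smul, mul_pow, norm_inv, Real.norm_eq_abs, inv_pow, sq_abs,
        Real.sq_sqrt (hη j)]
    rw [h1]
    by_cases h0 : η j = 0
    · simp [h0]
    · field_simp
  have hsum : ∑ s, r s ^ 2 + ∑ j, |η j| ≤ 2 * ∑ j, groupNorm b j := by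
    have h1 : ∑ s, r s ^ 2 ≤ ∑ j, η j := by
      refine (Finset.sum_le_sum fun s _ => hr s).trans ?_
      rw [Finset.sum_comm]
      simp only [hpen, le_refl]
    have h2 : ∑ j, |η j| = ∑ j, η j := Finset.sum_congr rfl fun j _ => abs_of_nonneg (hη j)
    rw [h2]
    linarith
  simp only [metaObjective, meanSqLoss, hpred]
  have := mul_le_mul_of_nonneg_left hsum (by positivity : 0 ≤ lam / 2)
  linarith

/-- The basic inequality of the group lasso for the difference `b - b₀`, where `b₀` is supported on
`J` and explains the data up to noise that is dominated by the regularization. -/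
lemma designNorm_sub_le (hm : 0 < m) (hn : 0 < n) (J : Finset (Fin p)) {b b₀ : Coeff m d}
    (hsupp : ∀ j ∉ J, ∀ s, b₀ s j = 0) {fs : Fin m → X → ℝ}
    (hpred₀ : ∀ s z, predict φ (b₀ s) z = fs s z) (hlam : 0 < lam) {ε : Fin m → Fin n → ℝ}
    (hε : ∀ j, √(∑ s, ‖∑ i, ε s i • φ j (x s i)‖ ^ 2) ≤ m * n * lam / 4)
    (hbasic : meanSqLoss φ x (fun s i => fs s (x s i) + ε s i) b + lam * ∑ j, groupNorm b j ≤
      meanSqLoss φ x (fun s i => fs s (x s i) + ε s i) b₀ + lam * ∑ j, groupNorm b₀ j) :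
    1 / (m * n) * designNorm φ x (fun s j => b s j - b₀ s j) ^ 2 ≤
      3 / 2 * lam * ∑ j ∈ J, groupNorm (fun s j => b s j - b₀ s j) j -
        lam / 2 * ∑ j ∈ Jᶜ, groupNorm (fun s j => b s j - b₀ s j) j := by
  have hm' : (0 : ℝ) < m := by exact_mod_cast hm
  have hn' : (0 : ℝ) < n := by exact_mod_cast hn
  set Δ : Coeff m d := fun s j => b s j - b₀ s j with hΔ
  have hpredΔ : ∀ s z, predict φ (b s) z = fs s z + predict φ (Δ s) z := by
    intro s z
    rw [← hpred₀, predict, predict, predict, ← Finset.sum_add_distrib]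
    refine Finset.sum_congr rfl fun j _ => ?_
    rw [← inner_add_right, hΔ]
    simp
  have hdesign : designNorm φ x Δ ^ 2 = ∑ s, ∑ i, predict φ (Δ s) (x s i) ^ 2 :=
    Real.sq_sqrt (Finset.sum_nonneg fun _ _ => Finset.sum_nonneg fun _ _ => sq_nonneg _)
  set cross : ℝ := ∑ s, ∑ i, ε s i * predict φ (Δ s) (x s i) with hcross
  have hloss : meanSqLoss φ x (fun s i => fs s (x s i) + ε s i) b =
      meanSqLoss φ x (fun s i => fs s (x s i) + ε s i) b₀ +
        1 / (m * n) * (designNorm φ x Δ ^ 2 - 2 * cross) := by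
    have hmean : ∀ F : Fin m → Fin n → ℝ, (1 / (m : ℝ)) * ∑ s, (1 / (n : ℝ)) * ∑ i, F s i =
        1 / (m * n) * ∑ s, ∑ i, F s i := by
      intro F
      rw [← Finset.mul_sum, ← mul_assoc]
      congr 1
      field_simp
    rw [meanSqLoss, meanSqLoss, hmean, hmean, hdesign, hcross, ← mul_add]
    congr 1
    simp only [Finset.mul_sum, ← Finset.sum_sub_distrib, ← Finset.sum_add_distrib]
    refine Finset.sum_congr rfl fun s _ => Finset.sum_congr rfl fun i _ => ?_
    rw [hpred₀, hpredΔ]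
    ring
  have hcross_le : cross ≤ m * n * lam / 4 * ∑ j, groupNorm Δ j := by
    have h1 : cross = ∑ j, ∑ s, inner ℝ (∑ i, ε s i • φ j (x s i)) (Δ s j) := by
      rw [hcross, Finset.sum_comm (s := (Finset.univ : Finset (Fin p)))]
      refine Finset.sum_congr rfl fun s _ => ?_
      simp only [predict, Finset.mul_sum, sum_inner, real_inner_smul_left]
      rw [Finset.sum_comm]
    rw [h1, Finset.mul_sum]
    refine Finset.sum_le_sum fun j _ => ?_
    have h2 : ∑ s, inner ℝ (∑ i, ε s i • φ j (x s i)) (Δ s j) =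
        inner ℝ (stackBlock (fun s j => ∑ i, ε s i • φ j (x s i)) j) (stackBlock Δ j) := by
      simp [stackBlock, PiLp.inner_apply]
    rw [h2]
    refine (real_inner_le_norm _ _).trans ?_
    rw [← groupNorm_eq_norm, ← groupNorm_eq_norm]
    exact mul_le_mul_of_nonneg_right (hε j) (groupNorm_nonneg _ _)
  have hpen : ∑ j, groupNorm b₀ j - ∑ j, groupNorm b j ≤
      ∑ j ∈ J, groupNorm Δ j - ∑ j ∈ Jᶜ, groupNorm Δ j := by
    rw [← Finset.sum_sub_distrib, ← Finset.sum_add_sum_compl J, sub_eq_add_neg,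
      ← Finset.sum_neg_distrib]
    refine add_le_add (Finset.sum_le_sum fun j hj => ?_) (Finset.sum_le_sum fun j hj => ?_)
    · have h1 : stackBlock Δ j = stackBlock b j - stackBlock b₀ j := rfl
      rw [groupNorm_eq_norm, groupNorm_eq_norm, groupNorm_eq_norm, h1, norm_sub_rev]
      exact norm_sub_norm_le _ _
    · have h1 : ∀ s, b₀ s j = 0 := hsupp j (Finset.mem_compl.1 hj)
      simp [groupNorm, hΔ, h1]
  have hsplit : ∑ j, groupNorm Δ j = ∑ j ∈ J, groupNorm Δ j + ∑ j ∈ Jᶜ, groupNorm Δ j :=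
    (Finset.sum_add_sum_compl J _).symm
  have h1 : 1 / (m * n) * (2 * cross) ≤ lam / 2 * ∑ j, groupNorm Δ j := by
    have := mul_le_mul_of_nonneg_left hcross_le (by positivity : (0 : ℝ) ≤ 1 / (m * n) * 2)
    have h2 : 1 / (m * n) * 2 * (m * n * lam / 4 * ∑ j, groupNorm Δ j) =
        lam / 2 * ∑ j, groupNorm Δ j := by field_simp; ring
    linarith
  have h3 := mul_le_mul_of_nonneg_left hpen hlam.le
  rw [hloss] at hbasic
  rw [hsplit] at h1
  linarith

/-- Under the restricted eigenvalue condition, an error that satisfies the basic inequality of the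
group lasso has only blocks shorter than `c₁`. -/
lemma groupNorm_lt_of_relaxedExploration (hm : 0 < m) (hn : 0 < n) {J : Finset (Fin p)} {S : ℕ}
    (hJ : J.card ≤ S) {c₁ : ℝ} (hc : 0 < c₁) {κ : ℝ} (hκ : 0 < κ) (hlam : 0 < lam)
    (hlamc : 8 * S * lam / κ ^ 2 ≤ c₁) (hRE : RelaxedExploration φ x S κ) {Δ : Coeff m d}
    (hmain : 1 / (m * n) * designNorm φ x Δ ^ 2 ≤
      3 / 2 * lam * ∑ j ∈ J, groupNorm Δ j - lam / 2 * ∑ j ∈ Jᶜ, groupNorm Δ j)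
    {j₀ : Fin p} (hj₀ : j₀ ∈ J) : groupNorm Δ j₀ < c₁ := by
  have hm' : (0 : ℝ) < m := by exact_mod_cast hm
  have hn' : (0 : ℝ) < n := by exact_mod_cast hn
  have hcone : ∑ j ∈ Jᶜ, groupNorm Δ j ≤ 3 * ∑ j ∈ J, groupNorm Δ j := by
    have h1 : 0 ≤ 1 / (m * n : ℝ) * designNorm φ x Δ ^ 2 := by positivity
    have h2 : 0 ≤ lam / 2 * (3 * ∑ j ∈ J, groupNorm Δ j - ∑ j ∈ Jᶜ, groupNorm Δ j) := by linarith
    have := nonneg_of_mul_nonneg_right h2 (by positivity)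
    linarith
  by_contra! hcΔ
  set N := √(∑ j ∈ J, groupNorm Δ j ^ 2) with hN
  have hgN : ∀ j ∈ J, groupNorm Δ j ≤ N := fun j hj =>
    Real.le_sqrt_of_sq_le (Finset.single_le_sum (f := fun j => groupNorm Δ j ^ 2)
      (fun _ _ => sq_nonneg _) hj)
  have hcN : c₁ ≤ N := hcΔ.trans (hgN j₀ hj₀)
  have hN0 : 0 < N := hc.trans_le hcN
  have hΔ0 : Δ ≠ 0 := by
    rintro rfl
    have h1 : groupNorm (0 : Coeff m d) j₀ = 0 := by simp [groupNorm]
    linarith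
  have hre := hRE J Δ hJ hΔ0 hcone
  have hsq : κ ^ 2 * N ^ 2 ≤ 1 / (m * n) * designNorm φ x Δ ^ 2 := by
    have h1 : (κ * (√((m : ℝ) * n) * N)) ^ 2 ≤ designNorm φ x Δ ^ 2 :=
      pow_le_pow_left₀ (mul_nonneg hκ.le (mul_nonneg (Real.sqrt_nonneg _) hN0.le)) hre 2
    rw [mul_pow, mul_pow, Real.sq_sqrt (by positivity)] at h1
    have h2 := mul_le_mul_of_nonneg_left h1 (by positivity : (0 : ℝ) ≤ 1 / (m * n))
    have h3 : 1 / (m * n) * (κ ^ 2 * (m * n * N ^ 2)) = κ ^ 2 * N ^ 2 := by field_simp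
    linarith
  have hS1 : (1 : ℝ) ≤ S := by
    exact_mod_cast (Finset.card_pos.2 ⟨j₀, hj₀⟩).trans_le hJ
  have hsumJ : ∑ j ∈ J, groupNorm Δ j ≤ S * N := by
    refine (Finset.sum_le_card_nsmul J _ N hgN).trans ?_
    rw [nsmul_eq_mul]
    exact mul_le_mul_of_nonneg_right (by exact_mod_cast hJ) hN0.le
  have hcompl : 0 ≤ lam / 2 * ∑ j ∈ Jᶜ, groupNorm Δ j :=
    mul_nonneg (by positivity) (Finset.sum_nonneg fun j _ => groupNorm_nonneg Δ j)
  have h1 : κ ^ 2 * N * N ≤ 3 / 2 * lam * S * N := by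
    have := mul_le_mul_of_nonneg_left hsumJ (by positivity : 0 ≤ 3 / 2 * lam)
    nlinarith
  have h2 : κ ^ 2 * N ≤ 3 / 2 * lam * S := le_of_mul_le_mul_right h1 hN0
  have h3 : 8 * S * lam ≤ c₁ * κ ^ 2 := by rwa [div_le_iff₀ (by positivity)] at hlamc
  have h4 : c₁ * κ ^ 2 ≤ N * κ ^ 2 := by gcongr
  have h5 : 0 < S * lam := by positivity
  linarith

/-- If the noise is dominated by the regularization, Meta-KeL keeps every base kernel whose
coefficient block is large: the error of the group lasso lies in the cone of the restricted
eigenvalue condition, so it is too small to cancel such a block. -/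
theorem subset_active_of_isMetaSolution (hm : 0 < m) (hn : 0 < n) {J : Finset (Fin p)} {S : ℕ}
    (hJ : J.card ≤ S) {β : Coeff m d} {fs : Fin m → X → ℝ}
    (hfs : ∀ s z, fs s z = ∑ j ∈ J, inner ℝ (φ j z) (β s j))
    {c₁ : ℝ} (hc : 0 < c₁) (hβ : ∀ j ∈ J, c₁ ≤ groupNorm β j) {κ : ℝ} (hκ : 0 < κ)
    (hlam : 0 < lam) (hlamc : 8 * S * lam / κ ^ 2 ≤ c₁)
    (hRE : RelaxedExploration φ x S κ) {ε : Fin m → Fin n → ℝ}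
    (hε : ∀ j, √(∑ s, ‖∑ i, ε s i • φ j (x s i)‖ ^ 2) ≤ m * n * lam / 4) {η : Fin p → ℝ}
    (hsol : IsMetaSolution φ lam x (fun s i => fs s (x s i) + ε s i) η) :
    J ⊆ active η := by
  obtain ⟨g, r, hfeas, hmin⟩ := hsol
  set b₀ : Coeff m d := fun s j => if j ∈ J then β s j else 0 with hb₀
  obtain ⟨b, hb0, hble⟩ := exists_groupLasso_le_metaObjective (x := x)
    (y := fun s i => fs s (x s i) + ε s i) hlam.le hfeas
  obtain ⟨η', g', r', hfeas', hle'⟩ := exists_metaObjective_le_groupLasso (φ := φ) (x := x)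
    (y := fun s i => fs s (x s i) + ε s i) hlam.le b₀
  have hbasic := (hble.trans (hmin η' g' r' hfeas')).trans hle'
  have hpred₀ : ∀ s z, predict φ (b₀ s) z = fs s z := by
    intro s z
    rw [hfs, predict, ← Finset.sum_filter_add_sum_filter_not Finset.univ (· ∈ J)]
    simp only [Finset.filter_mem_eq_inter, Finset.univ_inter]
    rw [Finset.sum_eq_zero (s := Finset.univ.filter fun j => j ∉ J), add_zero]
    · exact Finset.sum_congr rfl fun j hj => by simp [hb₀, hj]
    · intro j hj
      simp [hb₀, (Finset.mem_filter.1 hj).2]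
  have hmain := designNorm_sub_le hm hn J (fun j hj s => by simp [hb₀, hj]) hpred₀ hlam hε hbasic
  intro j₀ hj₀
  rw [active, Finset.mem_filter]
  refine ⟨Finset.mem_univ _, fun hη0 => ?_⟩
  -- the error in a discarded block is the block itself
  have h1 := groupNorm_lt_of_relaxedExploration hm hn hJ hc hκ hlam hlamc hRE hmain hj₀
  have h2 : groupNorm (fun s j => b s j - b₀ s j) j₀ = groupNorm β j₀ := by
    simp [groupNorm, hb0 j₀ hη0, hb₀, hj₀]
  rw [h2] at h1
  exact absurd (hβ j₀ hj₀) (not_le.2 h1)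

end SupportRecovery

/-! ### Noise in the meta-data -/

section MetaNoise

open Matrix

lemma one_add_mul_log_le {b : ℝ} (hb : 0 ≤ b) : (1 + b) * Real.log (1 + b) ≤ b + b ^ 2 / 2 := by
  have h1 : (0 : ℝ) < 1 + b := by linarith
  have h2 := Real.self_le_sinh_iff.2 (Real.log_nonneg (by linarith : 1 ≤ 1 + b))
  rw [Real.sinh_eq, Real.exp_neg, Real.exp_log h1] at h2
  have h3 := mul_le_mul_of_nonneg_left h2 h1.le
  have h4 : (1 + b) * ((1 + b - (1 + b)⁻¹) / 2) = b + b ^ 2 / 2 := by field_simp; ring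
  linarith

/-- The value `a = 2 √(L / (m d))` of the ratio between sample size and regularization balances the
two error terms of the self-normalized bound. The logarithm of the determinant must be kept in
dimension one, where the bound `log (1 + a) ≤ a` is too weak by a factor in the cross term. -/
lemma mixture_tuning {m d L : ℝ} (hm : 0 < m) (hL : 0 < L) (hd : d = 1 ∨ 2 ≤ d) :
    ∃ a : ℝ, 0 < a ∧ (1 + a) / a * (m * d * Real.log (1 + a / d) + 2 * L) ≤
      m + 2 * (L + √(m * d * L)) := by
  have hd0 : 0 < d := by rcases hd with h | h <;> linarith
  set y := √(L / (m * d)) with hy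
  have hy0 : 0 < y := Real.sqrt_pos.2 (by positivity)
  have hLy : L = m * d * y ^ 2 := by
    rw [hy, Real.sq_sqrt (by positivity)]; field_simp
  have hsq : √(m * d * L) = m * d * y := by
    rw [hLy, ← mul_assoc, ← sq, ← mul_pow, Real.sqrt_sq (by positivity)]
  refine ⟨2 * y, by positivity, ?_⟩
  have key : (1 + 2 * y) * (d * Real.log (1 + 2 * y / d)) ≤ 2 * y + 2 * d * y ^ 2 := by
    rcases hd with rfl | hd2
    · have := one_add_mul_log_le (by positivity : 0 ≤ 2 * y)
      rw [div_one]
      linarith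
    · have h1 : Real.log (1 + 2 * y / d) ≤ 2 * y / d := by
        have := Real.log_le_sub_one_of_pos (by positivity : 0 < 1 + 2 * y / d)
        linarith
      have h2 : d * Real.log (1 + 2 * y / d) ≤ 2 * y := by
        calc _ ≤ d * (2 * y / d) := by gcongr
          _ = _ := by field_simp
      have h3 := mul_le_mul_of_nonneg_left h2 (by positivity : 0 ≤ 1 + 2 * y)
      nlinarith [sq_nonneg y]
  rw [hsq, div_mul_eq_mul_div, div_le_iff₀ (by positivity)]
  have h1 := mul_le_mul_of_nonneg_left key hm.le
  rw [hLy]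
  nlinarith

variable {X : Type*} [MeasurableSpace X] {m n p : ℕ} {d : Fin p → ℕ}
  {φ : (j : Fin p) → X → EuclideanSpace ℝ (Fin (d j))} {Ω : Type*}

/-- The `t`-th feature vector of base kernel `j` in the order of collection: it sits in the block of
the task that is queried, and is zero once the meta-data is complete. -/
def metaFeature (φ : (j : Fin p) → X → EuclideanSpace ℝ (Fin (d j)))
    (order : Fin m × Fin n ≃ Fin (m * n)) (xm : Fin m → Fin n → Ω → X) (j : Fin p) (t : ℕ)
    (ω : Ω) : Fin m × Fin (d j) → ℝ := fun q =>
  if h : t < m * n then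
    if q.1 = (order.symm ⟨t, h⟩).1 then
      φ j (xm (order.symm ⟨t, h⟩).1 (order.symm ⟨t, h⟩).2 ω) q.2
    else 0
  else 0

/-- The `t`-th noise variable of the meta-data in the order of collection. -/
def metaNoise (order : Fin m × Fin n ≃ Fin (m * n)) (εm : Fin m → Fin n → Ω → ℝ) (t : ℕ) :
    Ω → ℝ :=
  if h : t < m * n then εm (order.symm ⟨t, h⟩).1 (order.symm ⟨t, h⟩).2 else fun _ => 0

variable {order : Fin m × Fin n ≃ Fin (m * n)} {xm : Fin m → Fin n → Ω → X}
  {εm : Fin m → Fin n → Ω → ℝ} {j : Fin p}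

omit [MeasurableSpace X] in
lemma metaFeature_order (s : Fin m) (i : Fin n) (ω : Ω) (q : Fin m × Fin (d j)) :
    metaFeature φ order xm j (order (s, i)) ω q = if q.1 = s then φ j (xm s i ω) q.2 else 0 := by
  simp [metaFeature]

lemma metaNoise_order (s : Fin m) (i : Fin n) : metaNoise order εm (order (s, i)) = εm s i := by
  simp [metaNoise]

/-- Sums over the order of collection are sums over tasks and samples. -/
lemma sum_range_order {M : Type*} [AddCommMonoid M] (order : Fin m × Fin n ≃ Fin (m * n))
    (F : ℕ → M) : ∑ t ∈ Finset.range (m * n), F t = ∑ s, ∑ i, F (order (s, i)) := by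
  rw [Finset.sum_range, ← Fintype.sum_prod_type' (fun s i => F (order (s, i))),
    ← Equiv.sum_comp order]

omit [MeasurableSpace X] in
lemma metaFeature_dotProduct (s : Fin m) (i : Fin n) (ω : Ω) (w : Fin m × Fin (d j) → ℝ) :
    metaFeature φ order xm j (order (s, i)) ω ⬝ᵥ w = ∑ q, φ j (xm s i ω) q * w (s, q) := by
  simp only [dotProduct, metaFeature_order, Fintype.sum_prod_type]
  rw [Finset.sum_eq_single s]
  · simp
  · intro s' _ hs
    simp [hs]
  · simp

omit [MeasurableSpace X] in
lemma noiseSum_meta_apply (ω : Ω) (s : Fin m) (q : Fin (d j)) :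
    noiseSum (fun t => metaFeature φ order xm j t ω) (fun t => metaNoise order εm t ω) (m * n)
      (s, q) = (∑ i, εm s i ω • φ j (xm s i ω)) q := by
  rw [noiseSum, sum_range_order order]
  simp only [Finset.sum_apply, Pi.smul_apply, metaFeature_order, metaNoise_order, smul_eq_mul]
  rw [Finset.sum_eq_single s]
  · simp
  · intro s' _ hs
    simp [hs.symm]
  · simp

omit [MeasurableSpace X] in
lemma noiseSum_meta_dotProduct_self (ω : Ω) :
    noiseSum (fun t => metaFeature φ order xm j t ω) (fun t => metaNoise order εm t ω) (m * n) ⬝ᵥ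
      noiseSum (fun t => metaFeature φ order xm j t ω) (fun t => metaNoise order εm t ω) (m * n) =
      ∑ s, ‖∑ i, εm s i ω • φ j (xm s i ω)‖ ^ 2 := by
  simp only [dotProduct, Fintype.sum_prod_type, noiseSum_meta_apply]
  refine Finset.sum_congr rfl fun s _ => ?_
  rw [EuclideanSpace.real_norm_sq_eq]
  exact Finset.sum_congr rfl fun q _ => (sq _).symm

omit [MeasurableSpace X] in
/-- Since tasks occupy orthogonal blocks, each direction is sampled at most `n` times. -/
lemma regGram_meta_quadForm_le (hφ : ∀ x, inner ℝ (φ j x) (φ j x) ≤ (1 : ℝ)) (ρ : ℝ) (ω : Ω)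
    (w : Fin m × Fin (d j) → ℝ) :
    w ⬝ᵥ regGram ρ (fun t => metaFeature φ order xm j t ω) (m * n) *ᵥ w ≤
      (ρ + n) * (w ⬝ᵥ w) := by
  rw [regGram_quadForm, add_mul, sum_range_order order fun t =>
    (metaFeature φ order xm j t ω ⬝ᵥ w) ^ 2]
  gcongr
  have h : ∀ s : Fin m, ∀ i : Fin n, (metaFeature φ order xm j (order (s, i)) ω ⬝ᵥ w) ^ 2 ≤
      ∑ q, w (s, q) ^ 2 := by
    intro s i
    rw [metaFeature_dotProduct]
    refine (Finset.sum_mul_sq_le_sq_mul_sq _ _ _).trans ?_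
    refine mul_le_of_le_one_left (Finset.sum_nonneg fun _ _ => sq_nonneg _) ?_
    have := hφ (xm s i ω)
    rwa [real_inner_self_eq_norm_sq, EuclideanSpace.real_norm_sq_eq] at this
  calc _ ≤ ∑ s : Fin m, ∑ _i : Fin n, ∑ q, w (s, q) ^ 2 :=
        Finset.sum_le_sum fun s _ => Finset.sum_le_sum fun i _ => h s i
    _ = n * (w ⬝ᵥ w) := by
        simp only [Finset.sum_const, Finset.card_univ, Fintype.card_fin, nsmul_eq_mul,
          ← Finset.mul_sum, dotProduct, Fintype.sum_prod_type, sq]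

omit [MeasurableSpace X] in
lemma log_det_regGram_meta_le (hφ : ∀ x, inner ℝ (φ j x) (φ j x) ≤ (1 : ℝ)) {ρ : ℝ} (hρ : 0 < ρ)
    (hd : 0 < d j) (ω : Ω) :
    Real.log (regGram ρ (fun t => metaFeature φ order xm j t ω) (m * n)).det ≤
      m * d j * Real.log (ρ + n / d j) := by
  have hd' : (0 : ℝ) < d j := by exact_mod_cast hd
  have hcard : (Fintype.card (Fin m × Fin (d j)) : ℝ) = m * d j := by simp
  rw [← hcard]
  refine log_det_le_of_trace_le (regGram_posDef hρ _ _) (by positivity) ?_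
  rw [regGram_trace, hcard, sum_range_order order fun t =>
    metaFeature φ order xm j t ω ⬝ᵥ metaFeature φ order xm j t ω]
  have h : ∀ s : Fin m, ∀ i : Fin n, metaFeature φ order xm j (order (s, i)) ω ⬝ᵥ
      metaFeature φ order xm j (order (s, i)) ω ≤ 1 := by
    intro s i
    rw [metaFeature_dotProduct]
    have := hφ (xm s i ω)
    rw [real_inner_self_eq_norm_sq, EuclideanSpace.real_norm_sq_eq] at this
    simpa [metaFeature_order, sq] using this
  calc _ ≤ ρ * (m * d j) + ∑ s : Fin m, ∑ _i : Fin n, (1 : ℝ) := by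
        gcongr with s _ i _
        exact h s i
    _ = _ := by
        simp only [Finset.sum_const, Finset.card_univ, Fintype.card_fin, nsmul_eq_mul, mul_one]
        field_simp

variable {mΩ : MeasurableSpace Ω} {P : Measure Ω} [IsProbabilityMeasure P]

/-- With high probability, the noise of one base kernel is dominated by the regularization. -/
lemma measure_metaNoise_block_le (hm : 0 < m) (hn : 0 < n) (hφm : Measurable (φ j))
    (hφ : ∀ x, inner ℝ (φ j x) (φ j x) ≤ (1 : ℝ)) (𝓕 : Filtration ℕ mΩ)
    (hxm : ∀ s i, Measurable[𝓕 (order (s, i) : ℕ)] (xm s i))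
    (hεm : ∀ s i, Measurable[𝓕 ((order (s, i) : ℕ) + 1)] (εm s i))
    (hind : ∀ s i, Indep (MeasurableSpace.comap (εm s i) inferInstance)
      (𝓕 (order (s, i) : ℕ)) P)
    {σ : ℝ≥0} (hσ : 0 < σ) (hsub : ∀ s i, HasSubgaussianMGF (εm s i) (σ ^ 2) P)
    {δ : ℝ} (hδ : 0 < δ) (hδ1 : δ < 1) {lam : ℝ} (hlam : lamMin σ m n d δ ≤ lam) :
    P {ω | ¬ √(∑ s, ‖∑ i, εm s i ω • φ j (xm s i ω)‖ ^ 2) ≤ m * n * lam / 4} ≤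
      ENNReal.ofReal (δ / (2 * p)) := by
  have hp : 0 < p := j.pos
  have hp' : (1 : ℝ) ≤ p := by exact_mod_cast hp
  have hm' : (0 : ℝ) < m := by exact_mod_cast hm
  have hn' : (0 : ℝ) < n := by exact_mod_cast hn
  set L := Real.log (2 * p / δ) with hL
  have hL0 : 0 < L := Real.log_pos (by rw [one_lt_div hδ]; linarith)
  have hrad : 0 ≤ m * n * lam / 4 ∧ n * (σ : ℝ) ^ 2 * (m + 2 * (L + √(m * (d j) * L))) ≤
      (m * n * lam / 4) ^ 2 := by
    have h1 : 0 ≤ lamMin σ m n d δ := by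
      rw [lamMin, rateFactor]; positivity
    have h2 : m * n * lamMin σ m n d δ / 4 = √((m : ℝ) * n) * σ * rateFactor m d δ := by
      rw [lamMin]
      have h3 : √((m : ℝ) * n) * √((m : ℝ) * n) = m * n := Real.mul_self_sqrt (by positivity)
      have h4 : √((m : ℝ) * n) ≠ 0 := (Real.sqrt_pos.2 (by positivity)).ne'
      field_simp
      rw [Real.sq_sqrt (by positivity)]
    have h5 : m * n * lamMin σ m n d δ / 4 ≤ m * n * lam / 4 := by gcongr
    have h6 : 0 ≤ m * n * lamMin σ m n d δ / 4 := by positivity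
    refine ⟨h6.trans h5, le_trans ?_ (pow_le_pow_left₀ h6 h5 2)⟩
    rw [h2, mul_pow, mul_pow, Real.sq_sqrt (by positivity), rateFactor,
      Real.sq_sqrt (by positivity),
      ← hL]
    have hdmax : (d j : ℝ) ≤ (Finset.univ.sup d : ℕ) := by
      exact_mod_cast Finset.le_sup (f := d) (Finset.mem_univ j)
    have h7 : √(m * (d j) * L) ≤ √((m : ℝ) * (Finset.univ.sup d : ℕ) * L) :=
      Real.sqrt_le_sqrt (by gcongr)
    have h8 : (m : ℝ) * n * σ ^ 2 * (1 + 2 / m * (L + √((m : ℝ) * (Finset.univ.sup d : ℕ) * L))) =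
        n * σ ^ 2 * (m + 2 * (L + √((m : ℝ) * (Finset.univ.sup d : ℕ) * L))) := by
      field_simp
    rw [h8]
    gcongr
  obtain ⟨hrad0, hrad⟩ := hrad
  rcases Nat.eq_zero_or_pos (d j) with hd0 | hdpos
  · have hz : ∀ v : EuclideanSpace ℝ (Fin (d j)), v = 0 := by
      intro v; ext q; exact absurd q.2 (by omega)
    have : {ω | ¬ √(∑ s, ‖∑ i, εm s i ω • φ j (xm s i ω)‖ ^ 2) ≤ m * n * lam / 4} = ∅ := by
      ext ω
      simp [hz, hrad0]
    rw [this]; simp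
  have hd' : (0 : ℝ) < d j := by exact_mod_cast hdpos
  have hd12 : (d j : ℝ) = 1 ∨ (2 : ℝ) ≤ d j := by
    rcases Nat.lt_or_ge (d j) 2 with h | h
    · left
      have : d j = 1 := by omega
      rw [this]; simp
    · right; exact_mod_cast h
  obtain ⟨a, ha, htune⟩ := mixture_tuning hm' hL0 hd12
  set ρ : ℝ := n / a with hρdef
  have hρ : 0 < ρ := by positivity
  have horder : ∀ t (h : t < m * n),
      (order ((order.symm ⟨t, h⟩).1, (order.symm ⟨t, h⟩).2) : ℕ) = t := fun t h => by simp
  have hψ : ∀ t, Measurable[𝓕 t] (metaFeature φ order xm j t) := by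
    intro t
    refine @measurable_pi_lambda _ _ _ (𝓕 t) _ _ fun q => ?_
    by_cases h : t < m * n
    · simp only [metaFeature, h, dite_true]
      have hx := hxm (order.symm ⟨t, h⟩).1 (order.symm ⟨t, h⟩).2
      rw [horder t h] at hx
      split_ifs
      · have h2 : Measurable fun v : EuclideanSpace ℝ (Fin (d j)) => v q.2 := by fun_prop
        exact h2.comp (hφm.comp hx)
      · exact measurable_const
    · simp only [metaFeature, h, dite_false]
      exact measurable_const
  have hε : ∀ t, Measurable[𝓕 (t + 1)] (metaNoise order εm t) := by
    intro t
    by_cases h : t < m * n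
    · have hx := hεm (order.symm ⟨t, h⟩).1 (order.symm ⟨t, h⟩).2
      rw [horder t h] at hx
      simpa only [metaNoise, h, dite_true] using hx
    · simp only [metaNoise, h, dite_false]
      exact measurable_const
  have hind' : ∀ t, Indep (MeasurableSpace.comap (metaNoise order εm t) inferInstance) (𝓕 t) P := by
    intro t
    by_cases h : t < m * n
    · have hx := hind (order.symm ⟨t, h⟩).1 (order.symm ⟨t, h⟩).2
      rw [horder t h] at hx
      simpa only [metaNoise, h, dite_true] using hx
    · simp only [metaNoise, h, dite_false, MeasurableSpace.comap_const]
      exact indep_bot_left _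
  have hsub' : ∀ t, HasSubgaussianMGF (metaNoise order εm t) (σ ^ 2) P := by
    intro t
    by_cases h : t < m * n
    · simpa only [metaNoise, h, dite_true] using hsub _ _
    · simp only [metaNoise, h, dite_false]
      refine ⟨fun u => by simp, fun u => ?_⟩
      simp only [mgf, mul_zero, Real.exp_zero, integral_const, probReal_univ, smul_eq_mul, mul_one]
      exact Real.one_le_exp (by positivity)
  have htail := measure_selfNorm_ge_le 𝓕 hψ hε hind' hσ hsub' hρ L
  have hexp : Real.exp (-L) = δ / (2 * p) := by
    rw [Real.exp_neg, hL, Real.exp_log (by positivity), inv_div]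
  rw [hexp] at htail
  refine (measure_mono fun ω hω => ?_).trans htail
  refine ⟨m * n, ?_⟩
  by_contra! hlt
  refine hω (Real.sqrt_le_iff.2 ⟨hrad0, ?_⟩)
  set Mv := noiseSum (fun t => metaFeature φ order xm j t ω) (fun t => metaNoise order εm t ω)
    (m * n) with hMv
  have hM : Mv ⬝ᵥ Mv ≤ (ρ + n) * selfNorm ρ (fun t => metaFeature φ order xm j t ω)
      (fun t => metaNoise order εm t ω) (m * n) := by
    have := inv_quadForm_le (G := regGram ρ (fun t => metaFeature φ order xm j t ω) (m * n))
      (G' := 1) (c := ρ + n) (regGram_posDef hρ _ _) PosDef.one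
      (fun w => by rw [one_mulVec]; exact regGram_meta_quadForm_le hφ ρ ω w) Mv
    rwa [inv_one, one_mulVec] at this
  rw [hMv, noiseSum_meta_dotProduct_self] at hM
  have hdet := log_det_regGram_meta_le (order := order) (xm := xm) hφ hρ hdpos ω
  have hcard : (Fintype.card (Fin m × Fin (d j)) : ℝ) = m * d j := by simp
  rw [hcard] at hlt
  have hlog : Real.log (ρ + n / d j) = Real.log ρ + Real.log (1 + a / d j) := by
    rw [← Real.log_mul hρ.ne' (by positivity)]
    congr 1
    rw [hρdef]; field_simp
  have hQ : selfNorm ρ (fun t => metaFeature φ order xm j t ω)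
      (fun t => metaNoise order εm t ω) (m * n) ≤
      (σ : ℝ) ^ 2 * (m * d j * Real.log (1 + a / d j) + 2 * L) := by
    refine hlt.le.trans ?_
    gcongr
    rw [hlog] at hdet
    linarith
  calc ∑ s, ‖∑ i, εm s i ω • φ j (xm s i ω)‖ ^ 2
      ≤ (ρ + n) * ((σ : ℝ) ^ 2 * (m * d j * Real.log (1 + a / d j) + 2 * L)) :=
        hM.trans (by gcongr)
    _ = n * (σ : ℝ) ^ 2 * ((1 + a) / a * (m * d j * Real.log (1 + a / d j) + 2 * L)) := by
        rw [hρdef]; field_simp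
    _ ≤ n * (σ : ℝ) ^ 2 * (m + 2 * (L + √(m * (d j) * L))) := by gcongr
    _ ≤ _ := hrad

/-- With probability at least `1 - δ / 2`, the regularization dominates the noise of every base
kernel. -/
theorem measure_metaNoise_le (hm : 0 < m) (hn : 0 < n) (hφm : ∀ j, Measurable (φ j))
    (hφ : ∀ j x, inner ℝ (φ j x) (φ j x) ≤ (1 : ℝ)) (𝓕 : Filtration ℕ mΩ)
    (hxm : ∀ s i, Measurable[𝓕 (order (s, i) : ℕ)] (xm s i))
    (hεm : ∀ s i, Measurable[𝓕 ((order (s, i) : ℕ) + 1)] (εm s i))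
    (hind : ∀ s i, Indep (MeasurableSpace.comap (εm s i) inferInstance)
      (𝓕 (order (s, i) : ℕ)) P)
    {σ : ℝ≥0} (hσ : 0 < σ) (hsub : ∀ s i, HasSubgaussianMGF (εm s i) (σ ^ 2) P)
    {δ : ℝ} (hδ : 0 < δ) (hδ1 : δ < 1) {lam : ℝ} (hlam : lamMin σ m n d δ ≤ lam) :
    P {ω | ¬ ∀ j, √(∑ s, ‖∑ i, εm s i ω • φ j (xm s i ω)‖ ^ 2) ≤ m * n * lam / 4} ≤
      ENNReal.ofReal (δ / 2) := by
  have hU : {ω | ¬ ∀ j, √(∑ s, ‖∑ i, εm s i ω • φ j (xm s i ω)‖ ^ 2) ≤ m * n * lam / 4} =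
      ⋃ j, {ω | ¬ √(∑ s, ‖∑ i, εm s i ω • φ j (xm s i ω)‖ ^ 2) ≤ m * n * lam / 4} := by
    ext ω; simp
  rw [hU]
  refine (measure_iUnion_fintype_le _ _).trans ((Finset.sum_le_sum fun j _ =>
    measure_metaNoise_block_le hm hn (hφm j) (hφ j) 𝓕 hxm hεm hind hσ hsub hδ hδ1 hlam).trans ?_)
  rw [Finset.sum_const, Finset.card_univ, Fintype.card_fin, nsmul_eq_mul]
  rcases Nat.eq_zero_or_pos p with rfl | hp
  · simp
  · have hp' : (0 : ℝ) < p := by exact_mod_cast hp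
    rw [← ENNReal.ofReal_natCast, ← ENNReal.ofReal_mul hp'.le]
    refine ENNReal.ofReal_le_ofReal (le_of_eq ?_)
    field_simp

end MetaNoise

/-! ### Regret with the meta-learned kernel -/

section MetaRegret

open Matrix

variable {X : Type*} {m n p : ℕ} {d : Fin p → ℕ}
  {φ : (j : Fin p) → X → EuclideanSpace ℝ (Fin (d j))}

/-- The unweighted features of the base kernels in `A`, as one vector. -/
def selFeature (φ : (j : Fin p) → X → EuclideanSpace ℝ (Fin (d j))) (A : Finset (Fin p)) (x : X) :
    ((j : {j // j ∈ A}) × Fin (d j)) → ℝ :=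
  fun q => φ q.1 x q.2

lemma card_selFeature_index (A : Finset (Fin p)) :
    Fintype.card ((j : {j // j ∈ A}) × Fin (d j)) = ∑ j ∈ A, d j := by
  rw [Fintype.card_sigma]
  simp only [Fintype.card_fin]
  exact Finset.sum_coe_sort A d

lemma sum_selFeature (A : Finset (Fin p)) (w : Fin p → ℝ)
    (c : (j : Fin p) → EuclideanSpace ℝ (Fin (d j))) (x : X) (hw : ∀ j ∉ A, w j = 0) :
    ∑ q : (j : {j // j ∈ A}) × Fin (d j), w q.1 * (selFeature φ A x q * c q.1 q.2) =
      ∑ j, w j * inner ℝ (φ j x) (c j) := by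
  have h : ∀ j, w j * inner ℝ (φ j x) (c j) = ∑ i, w j * (φ j x i * c j i) := by
    intro j
    rw [← Finset.mul_sum]
    simp [PiLp.inner_apply, mul_comm]
  rw [Fintype.sum_sigma, ← Finset.sum_subset (Finset.subset_univ A) fun j _ hj => by simp [hw j hj],
    ← Finset.sum_coe_sort A]
  exact Finset.sum_congr rfl fun j _ => (h j).symm

lemma selFeature_dotProduct_self_le (hφ : ∀ j x, inner ℝ (φ j x) (φ j x) ≤ (1 : ℝ))
    (A : Finset (Fin p)) (x : X) : selFeature φ A x ⬝ᵥ selFeature φ A x ≤ A.card := by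
  rw [dotProduct, Fintype.sum_sigma]
  calc _ = ∑ j : {j // j ∈ A}, inner ℝ (φ j x) (φ j x) := by
        refine Finset.sum_congr rfl fun j _ => ?_
        rw [real_inner_self_eq_norm_sq, EuclideanSpace.real_norm_sq_eq]
        exact Finset.sum_congr rfl fun i _ => (sq _).symm
    _ ≤ ∑ j : {j // j ∈ A}, (1 : ℝ) := Finset.sum_le_sum fun j _ => hφ j x
    _ = A.card := by simp

/-- Regret of GP-UCB with the meta-learned kernel along a path, provided that all base kernels of
the true kernel were recovered. -/
theorem eventually_metaRegret_le (hφ : ∀ j x, inner ℝ (φ j x) (φ j x) ≤ (1 : ℝ))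
    {ηstar : Fin p → ℝ} (hηstar : ∀ j, 0 ≤ ηstar j) {B r : ℝ} {f : X → ℝ}
    (hf : HasRKHSNorm (mixKernel φ ηstar) f r) (hB : 0 ≤ B) {xstar : X}
    (hmax : ∀ x, f x ≤ f xstar) {η : Fin p → ℝ} (hη : ∀ j, 0 ≤ η j)
    (hsupp : active ηstar ⊆ active η) (hdim : ∀ j ∈ active ηstar, d j ≠ 0)
    {σ c₁ δ e : ℝ} (hσ : 0 < σ) (hc : 0 < c₁) (hδ : 0 < δ) (hδ1 : δ < 1) (he : 0 ≤ e)
    {x : ℕ → X} {ε : ℕ → ℝ}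
    (hucb : IsGPUCB (metaKernel φ c₁ η) (explCoeff σ B c₁ δ e (effDim d η)) x
      (fun t => f (x t) + ε t))
    (hnoise : ∀ (A : Finset (Fin p)) (N : ℕ), 0 < ∑ j ∈ A, d j → ∀ᶠ t : ℕ in atTop,
      selfNorm (1 / (N + 1)) (fun s => selFeature φ A (x s)) ε t ≤
        σ ^ 2 * (((∑ j ∈ A, d j : ℕ) - 1 / 8) * Real.log t)) :
    (∀ᶠ T : ℕ in atTop, regret f xstar x T ≤
      (14 * σ + 1) * regretRate B δ e (effDim d η) T) ∧
    Tendsto (fun T : ℕ => regret f xstar x T / T) atTop (𝓝 0) := by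
  obtain ⟨-, c, hfc, -⟩ := exists_coeff_of_hasRKHSNorm hηstar hf
  rcases Nat.eq_zero_or_pos (effDim d η) with hD | hD
  · -- no feature survives, so the true kernel is zero
    have hzero : ∀ j, ηstar j = 0 := by
      intro j
      by_contra hj
      have hjs : j ∈ active ηstar := by simp [active, hj]
      exact hdim j hjs (Finset.sum_eq_zero_iff.1 hD j (hsupp hjs))
    have hreg : ∀ T, regret f xstar x T = 0 := by
      intro T
      simp [regret, hfc, hzero]
    refine ⟨.of_forall fun T => ?_, by simp [hreg]⟩
    simp [hreg, regretRate, hD]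
  · set A := active η with hA
    have hnotA : ∀ j ∉ A, η j = 0 := fun j hj => by simpa [hA, active] using hj
    have hposA : ∀ j ∈ A, 0 < η j := fun j hj =>
      (hη j).lt_of_ne' (by simpa [hA, active] using hj)
    have hnotA' : ∀ j ∉ A, ηstar j = 0 := fun j hj => by
      simpa [active] using fun h => hj (hsupp h)
    have hcard : Fintype.card ((j : {j // j ∈ A}) × Fin (d j)) = effDim d η :=
      card_selFeature_index A
    have : Nonempty ((j : {j // j ∈ A}) × Fin (d j)) :=
      Fintype.card_pos_iff.1 (by rw [hcard]; exact hD)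
    set W : ((j : {j // j ∈ A}) × Fin (d j)) → ℝ := fun q => η q.1 / c₁ with hWdef
    have hW : ∀ q, 0 < W q := fun q => div_pos (hposA q.1 q.1.2) hc
    obtain ⟨N, hN⟩ := exists_nat_ge (∑ q, W q)
    have hWN : ∀ q, 1 / ((N : ℝ) + 1) * W q ≤ 1 := by
      intro q
      have h1 : W q ≤ ∑ q, W q :=
        Finset.single_le_sum (fun q _ => (hW q).le) (Finset.mem_univ q)
      rw [one_div_mul_eq_div, div_le_one (by positivity)]
      linarith
    have hk : ∀ z z', metaKernel φ c₁ η z z' =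
        ∑ q, W q * (selFeature φ A z q * selFeature φ A z' q) := fun z z' =>
      (sum_selFeature A (fun j => η j / c₁) (fun j => φ j z') z
        fun j hj => by simp [hnotA j hj]).symm
    have hfθ : ∀ z, f z = (fun q => √(ηstar q.1) * c q.1 q.2) ⬝ᵥ selFeature φ A z := by
      intro z
      rw [hfc, ← sum_selFeature A (fun j => √(ηstar j)) c z fun j hj => by simp [hnotA' j hj]]
      exact Finset.sum_congr rfl fun q _ => by ring
    rw [← hcard] at hucb ⊢
    refine eventually_regret_le hW hk (by positivity : (0 : ℝ) < 1 / ((N : ℝ) + 1)) hWN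
      (selFeature_dotProduct_self_le hφ A) hfθ hmax hσ hc hδ hδ1 hB he hucb ?_
    rw [hcard]
    exact hnoise A N hD

end MetaRegret

end MetaKeL

open MetaKeL

theorem mainTheorem5 (σ : ℝ≥0) (hσ : 0 < σ) :
    ∃ C : ℝ, 0 < C ∧
    -- compact domain and base kernels
    ∀ (d₀ : ℕ) (X : Set (EuclideanSpace ℝ (Fin d₀))) (_ : IsCompact X)
      (p : ℕ) (d : Fin p → ℕ) (φ : (j : Fin p) → X → EuclideanSpace ℝ (Fin (d j)))
      (_ : ∀ j, Continuous (φ j)) (_ : ∀ j x x', inner ℝ (φ j x) (φ j x') ≤ 1)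
    -- true kernel
      (ηstar : Fin p → ℝ) (_ : ∀ j, 0 ≤ ηstar j) (_ : ∑ j, ηstar j ≤ 1)
    -- task functions and reward function
      (m n : ℕ) (_ : 0 < m) (_ : 0 < n) (B : ℝ) (fs : Fin m → X → ℝ)
      (_ : ∀ s, ∃ r ≤ B, MetaKeL.HasRKHSNorm (MetaKeL.mixKernel φ ηstar) (fs s) r)
      (f : X → ℝ) (_ : ∃ r ≤ B, MetaKeL.HasRKHSNorm (MetaKeL.mixKernel φ ηstar) f r)
      (xstar : X) (_ : ∀ x, f x ≤ f xstar)
    -- coefficients of the task functions, and the group beta-min condition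
      (β : MetaKeL.Coeff m d)
      (_ : ∀ s x, fs s x = ∑ j ∈ MetaKeL.active ηstar, inner ℝ (φ j x) (β s j))
      (c₁ : ℝ) (_ : 0 < c₁) (_ : ∀ j ∈ MetaKeL.active ηstar, c₁ ≤ MetaKeL.groupNorm β j)
    -- sparsity, exploration constant, confidence level, regularization
      (S : ℕ) (_ : (MetaKeL.active ηstar).card ≤ S) (κ : ℝ) (_ : 0 < κ)
      (δ : ℝ) (_ : 0 < δ) (_ : δ < 1)
      (lam : ℝ) (_ : MetaKeL.lamMin σ m n d δ ≤ lam) (_ : 8 * S * lam / κ ^ 2 ≤ c₁)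
    -- probability space; the filtration first runs through the meta-data in some order
      (Ω : Type*) (mΩ : MeasurableSpace Ω) (P : Measure Ω) (_ : IsProbabilityMeasure P)
      (𝓕 : Filtration ℕ mΩ) (order : Fin m × Fin n ≃ Fin (m * n))
    -- meta-data: predictable inputs, independent sub-Gaussian noise, exploration
      (xm : Fin m → Fin n → Ω → X) (_ : ∀ s i, Measurable[𝓕 (order (s, i) : ℕ)] (xm s i))
      (εm : Fin m → Fin n → Ω → ℝ) (_ : ∀ s i, Measurable[𝓕 ((order (s, i) : ℕ) + 1)] (εm s i))
      (_ : ∀ s i, Indep (MeasurableSpace.comap (εm s i) inferInstance) (𝓕 (order (s, i) : ℕ)) P)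
      (_ : ∀ s i, HasSubgaussianMGF (εm s i) (σ ^ 2) P)
      (_ : ∀ᵐ ω ∂P, MetaKeL.RelaxedExploration φ (fun s i => xm s i ω) S κ)
    -- meta-learned weights
      (ηhat : Ω → Fin p → ℝ) (_ : Measurable[𝓕 (m * n)] ηhat)
      (_ : ∀ ω, MetaKeL.IsMetaSolution φ lam (fun s i => xm s i ω)
        (fun s i => fs s (xm s i ω) + εm s i ω) (ηhat ω))
    -- online phase: predictable inputs chosen by GP-UCB, independent sub-Gaussian noise
      (x : ℕ → Ω → X) (_ : ∀ t, Measurable[𝓕 (m * n + t)] (x t))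
      (ε : ℕ → Ω → ℝ) (_ : ∀ t, Measurable[𝓕 (m * n + t + 1)] (ε t))
      (_ : ∀ t, Indep (MeasurableSpace.comap (ε t) inferInstance) (𝓕 (m * n + t)) P)
      (_ : ∀ t, HasSubgaussianMGF (ε t) (σ ^ 2) P)
      (_ : ∀ ω, MetaKeL.IsGPUCB (MetaKeL.metaKernel φ c₁ (ηhat ω))
        (MetaKeL.explCoeff σ B c₁ δ (MetaKeL.recoveryErr σ m n d δ κ S)
          (MetaKeL.effDim d (ηhat ω)))
        (fun t => x t ω) (fun t => f (x t ω) + ε t ω)),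
    ∃ T₀ : ℕ, ENNReal.ofReal (1 - δ) < P {ω |
      (∀ T ≥ T₀, MetaKeL.regret f xstar (fun t => x t ω) T ≤
        C * MetaKeL.regretRate B δ (MetaKeL.recoveryErr σ m n d δ κ S)
          (MetaKeL.effDim d (ηhat ω)) T) ∧
      Tendsto (fun T : ℕ => MetaKeL.regret f xstar (fun t => x t ω) T / T) atTop (𝓝 0)} := by
  have hσ' : (0 : ℝ) < σ := hσ
  refine ⟨14 * σ + 1, by positivity, ?_⟩
  intro d₀ X _ p d φ hφc hφ1 ηstar hηstar _ m n hm hn B fs _ f ⟨r, hrB, hf⟩ xstar hmax β hβ c₁ hc₁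
    hβc S hS κ hκ δ hδ hδ1 lam hlam hlamc Ω mΩ P hP 𝓕 order xm hxm εm hεm hindm hsubm hRE ηhat _
    hsol x hx ε hε hind hsub hucb
  have hφm : ∀ j, Measurable (φ j) := fun j => (hφc j).measurable
  have hB : 0 ≤ B := (exists_coeff_of_hasRKHSNorm hηstar hf).1.trans hrB
  have he : 0 ≤ recoveryErr σ m n d δ κ S := by
    rw [recoveryErr, rateFactor]; positivity
  -- an active block has positive length, so its dimension is positive
  have hdim : ∀ j ∈ active ηstar, d j ≠ 0 := by
    intro j hj h0
    have h1 : ∀ v : EuclideanSpace ℝ (Fin (d j)), v = 0 := by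
      intro v; ext q; exact absurd q.2 (by omega)
    have h2 : groupNorm β j = 0 := by simp [groupNorm, h1]
    linarith [hβc j hj]
  let 𝓖 : Filtration ℕ mΩ :=
    { seq := fun t => 𝓕 (m * n + t)
      mono' := fun s t h => 𝓕.mono (Nat.add_le_add_left h _)
      le' := fun t => 𝓕.le _ }
  -- the learned support and the regularization depend on the path, so the growth bound is taken
  -- simultaneously over all sets of kernels and the regularizations `1 / (N + 1)`
  have honline : ∀ᵐ ω ∂P, ∀ (A : Finset (Fin p)) (N : ℕ), 0 < ∑ j ∈ A, d j →
      ∀ᶠ t : ℕ in atTop,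
        selfNorm (1 / (N + 1)) (fun s => selFeature φ A (x s ω)) (fun s => ε s ω) t ≤
          (σ : ℝ) ^ 2 * (((∑ j ∈ A, d j : ℕ) - 1 / 8) * Real.log t) := by
    rw [ae_all_iff]; intro A
    rw [ae_all_iff]; intro N
    by_cases hA : 0 < ∑ j ∈ A, d j
    · have hcard := card_selFeature_index (d := d) A
      have : Nonempty ((j : {j // j ∈ A}) × Fin (d j)) :=
        Fintype.card_pos_iff.1 (by rw [hcard]; exact hA)
      have hψ : ∀ t, Measurable[𝓖 t] fun ω => selFeature φ A (x t ω) := by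
        intro t
        refine @measurable_pi_lambda _ _ _ (𝓖 t) _ _ fun q => ?_
        have h2 : Measurable fun v : EuclideanSpace ℝ (Fin (d q.1)) => v q.2 := by fun_prop
        exact h2.comp ((hφm q.1).comp (hx t))
      have h := ae_eventually_selfNorm_le 𝓖 hψ (fun t => hε t) (fun t => hind t) hσ hsub
        (by positivity : (0 : ℝ) < 1 / ((N : ℝ) + 1)) (Nat.cast_nonneg A.card)
        (fun s ω => selFeature_dotProduct_self_le (fun j x => hφ1 j x x) A (x s ω))
      rw [hcard] at h
      filter_upwards [h] with ω hω _ using hω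
    · exact ae_of_all _ fun ω h => absurd h hA
  set good : ℕ → Set Ω := fun T₀ => {ω |
    (∀ T ≥ T₀, regret f xstar (fun t => x t ω) T ≤
      (14 * σ + 1) * regretRate B δ (recoveryErr σ m n d δ κ S) (effDim d (ηhat ω)) T) ∧
    Tendsto (fun T : ℕ => regret f xstar (fun t => x t ω) T / T) atTop (𝓝 0)} with hgood
  have hmono : Monotone good := fun a b hab ω hω =>
    ⟨fun T hT => hω.1 T (hab.trans hT), hω.2⟩
  set noiseEvent : Set Ω := {ω | ¬ ∀ j,
    √(∑ s, ‖∑ i, εm s i ω • φ j (xm s i ω)‖ ^ 2) ≤ m * n * lam / 4} with hnoiseEvent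
  have hmeta : P noiseEvent ≤ ENNReal.ofReal (δ / 2) :=
    measure_metaNoise_le hm hn hφm (fun j x => hφ1 j x x) 𝓕 hxm hεm hindm hσ hsubm hδ hδ1 hlam
  have hcover : ∀ᵐ ω ∂P, ω ∈ noiseEvent ∪ ⋃ T₀, good T₀ := by
    filter_upwards [hRE, honline] with ω hREω hω
    by_cases hnoise : ∀ j, √(∑ s, ‖∑ i, εm s i ω • φ j (xm s i ω)‖ ^ 2) ≤ m * n * lam / 4
    · right
      have hsupp : active ηstar ⊆ active (ηhat ω) := by
        intro j hj
        have hp : (0 : ℝ) < p := by exact_mod_cast j.pos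
        have hlog : 0 ≤ Real.log (2 * p / δ) := by
          refine Real.log_nonneg ?_
          rw [le_div_iff₀ hδ]
          have : (1 : ℝ) ≤ p := by exact_mod_cast j.pos
          linarith
        have hlam0 : 0 < lam := by
          refine lt_of_lt_of_le ?_ hlam
          have hm' : (0 : ℝ) < m := by exact_mod_cast hm
          have hn' : (0 : ℝ) < n := by exact_mod_cast hn
          have : 0 < rateFactor m d δ := by
            rw [rateFactor]
            exact Real.sqrt_pos.2 (by positivity)
          rw [lamMin]
          positivity
        exact subset_active_of_isMetaSolution hm hn hS hβ hc₁ hβc hκ hlam0 hlamc hREω hnoise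
          (hsol ω) hj
      have hη : ∀ j, 0 ≤ ηhat ω j := by
        obtain ⟨_, _, hfeas, _⟩ := hsol ω
        exact hfeas.1
      obtain ⟨h1, h2⟩ := eventually_metaRegret_le (fun j x => hφ1 j x x) hηstar hf hB hmax hη
        hsupp hdim hσ' hc₁ hδ hδ1 he (hucb ω) hω
      obtain ⟨T₀, hT₀⟩ := eventually_atTop.1 h1
      exact Set.mem_iUnion.2 ⟨T₀, hT₀, h2⟩
    · exact Or.inl hnoise
  -- the noise of the meta-data fails with probability at most `δ / 2` only; this slack makes the
  -- inequality strict, so that it survives the passage to some finite `T₀`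
  have hlt : ENNReal.ofReal (1 - δ) < P (⋃ T₀, good T₀) := by
    have h1 : (1 : ℝ≥0∞) ≤ ENNReal.ofReal (δ / 2) + P (⋃ T₀, good T₀) := by
      have h2 : P (noiseEvent ∪ ⋃ T₀, good T₀) = 1 := by
        rw [← measure_univ (μ := P)]
        exact measure_congr (eventuallyEq_univ.2 hcover)
      rw [← h2]
      exact (measure_union_le _ _).trans (by gcongr)
    have h3 : ENNReal.ofReal (1 - δ / 2) ≤ P (⋃ T₀, good T₀) := by
      rw [ENNReal.ofReal_sub _ (by positivity), ENNReal.ofReal_one]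
      exact tsub_le_iff_left.2 h1
    refine lt_of_lt_of_le ?_ h3
    exact (ENNReal.ofReal_lt_ofReal_iff (by linarith)).2 (by linarith)
  rw [hmono.measure_iUnion] at hlt
  exact lt_iSup_iff.1 hlt
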